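/- Let $V$ be a finite set, $n=|V|$, let $\mu$ be a probability distribution on $\{-1,+1\}^V$ with support $\Omega(\mu)$, and let $\eta>0$ be real. For $\Lambda\subseteq V$ write $\mu_\Lambda$ for the marginal of $\mu$ on $\Lambda$; for $\sigma_\Lambda\in\Omega(\mu_\Lambda)$ write $\mu^{\sigma_\Lambda}$ for $\mu$ conditioned on the configuration on $\Lambda$ being $\sigma_\Lambda$, and $\mu^{\sigma_\Lambda}_v$ for the marginal of $\mu^{\sigma_\Lambda}$ at $v\in V$. **Complete spectral independence.** For $\Lambda\subseteq V$ and $\sigma_\Lambda\in\Omega(\mu_\Lambda)$, the influence matrix $\Psi_\mu^{\sigma_\Lambda}$, indexed by $V\setminus\Lambda$, has zero diagonal, and for distinct $u,v\in V\setminus\Lambda$ $$\Psi_\mu^{\sigma_\Lambda}(u,v)=\max_{c,c'\in\Omega(\mu_u^{\sigma_\Lambda})} d_{\mathrm{TV}}\bigl(\mu_v^{\sigma_\Lambda,u\leftarrow c},\mu_v^{\sigma_\Lambda,u\leftarrow c'}\bigr),$$ where $\mu_v^{\sigma_\Lambda,u\leftarrow c}$ is the marginal at $v$ of $\mu^{\sigma_\Lambda}$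 further conditioned on $u$ having value $c$. The distribution $\mu$ is $\eta$-spectrally independent if, for all $\Lambda\subseteq V$ and $\sigma_\Lambda\in\Omega(\mu_\Lambda)$, the spectral radius of $\Psi_\mu^{\sigma_\Lambda}$ is at most $\eta$. For $\phi\in(0,1]^V$ let $\mu^{(\phi)}$ be the probability distribution with $\mu^{(\phi)}(\sigma)\propto\mu(\sigma)\prod_{v:\sigma_v=+1}\phi_v$. The distribution $\mu$ is completely $\eta$-spectrally independent if $\mu^{(\phi)}$ is $\eta$-spectrally independent for all $\phi\in(0,1]^V$. **$k$-transformation.** For an integer $k\ge1$, $\mu_k$ is the law of the following random $Y\in\{-1,+1\}^{V\times[k]}$. Draw $X\sim\mu$. For each $v$ with $X_v=-1$, set $Y_{(v,i)}=-1$ for all $i\in[k]$. For each $v$ with $X_v=+1$, choose $i^*_v\in[k]$ uniformly and independently at random, and set $Y_{(v,i^*_v)}=+1$ and $Y_{(v,i)}=-1$ for all $i\ne i^*_v$. **Uniform block dynamics.** For a distribution $\nu$ on $\{-1,+1\}^U$ with $U$ finite and $1\le\ell\le|U|$, the (heat-bath) uniform $\ell$-block dynamics for $\nu$ is the Markov chain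 on $\Omega(\nu)$ which in each step chooses $S\subseteq U$ with $|S|=\ell$ uniformly at random and resamples the configuration on $S$ from $\nu$ conditioned on the current configuration on $U\setminus S$. This chain is reversible with respect to $\nu$. Its spectral gap is $1-\lambda_2$, where $1=\lambda_1\ge\lambda_2\ge\cdots$ are the eigenvalues, with multiplicity, of its transition matrix; $\lambda_2=0$ by convention if $|\Omega(\nu)|=1$. **Lemma.** If $\mu$ is completely $\eta$-spectrally independent, then for all integers $k\ge1$ and $\ell$ with $2(\eta+3)\le\ell\le kn$, the transition matrix $P_{k,\ell}$ of the uniform $\ell$-block dynamics for $\mu_k$ satisfies $$\mathrm{gap}(P_{k,\ell})\ \ge\ \left(\frac{\ell}{2kn}\right)^{2\eta+7}.$$ -/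

import Mathlib

namespace BlockDynamics

open Finset

/-- The set of spins, literally `{-1, +1}`, realized as the units of `ℤ`. -/
abbrev Spin : Type := ℤˣ

section Distributions

variable {V : Type*} [Fintype V] [DecidableEq V]

/-- Partial configurations on `Λ` are functions `Λ → Spin`. This is the event (set of full
configurations) that the configuration on `Λ` equals `σ`. -/
def agreeSet (Λ : Finset V) (σ : Λ → Spin) : Finset (V → Spin) :=
  univ.filter fun τ => ∀ v : Λ, τ v = σ v

/-- The marginal distribution `μ_Λ` on `{-1,+1}^Λ`. -/
noncomputable def marginal (μ : (V → Spin) → ℝ) (Λ : Finset V) (σ : Λ → Spin) : ℝ :=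
  ∑ τ ∈ agreeSet Λ σ, μ τ

/-- The marginal distribution of a single variable `v`, as a function on `{-1,+1}`. -/
noncomputable def vertexMarginal (μ : (V → Spin) → ℝ) (v : V) (c : Spin) : ℝ :=
  ∑ τ ∈ univ.filter (fun τ : V → Spin => τ v = c), μ τ

/-- The conditional distribution of `μ` given an event `E`, that is
`τ ↦ Pr[X = τ | X ∈ E]` (only used when `E` has positive probability). -/
noncomputable def condOn (μ : (V → Spin) → ℝ) (E : Finset (V → Spin)) (τ : V → Spin) : ℝ :=
  if τ ∈ E then μ τ / ∑ ω ∈ E, μ ω else 0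

/-- `μ^{σ_Λ}`: the distribution on `{-1,+1}^V` obtained from `μ` by conditioning on the
configuration on `Λ` being `σ`. -/
noncomputable def pin (μ : (V → Spin) → ℝ) (Λ : Finset V) (σ : Λ → Spin) : (V → Spin) → ℝ :=
  condOn μ (agreeSet Λ σ)

/-- `μ^{u ← c}`: `μ` conditioned on the value of the variable `u` being `c`. -/
noncomputable def pinVertex (μ : (V → Spin) → ℝ) (u : V) (c : Spin) : (V → Spin) → ℝ :=
  condOn μ (univ.filter fun τ : V → Spin => τ u = c)

/-- Total variation distance of two distributions on a finite set. -/
noncomputable def tvDist {α : Type*} [Fintype α] (p q : α → ℝ) : ℝ :=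
  1 / 2 * ∑ a, |p a - q a|

/-- The absolute influence matrix `Ψ_μ^{σ_Λ}`, indexed by `V \ Λ`. Its diagonal vanishes, and for
distinct `u, v` its entry is the maximum, over the spins `c, c'` in the support of
`μ_u^{σ_Λ}`, of the total variation distance of `μ_v^{σ_Λ, u ← c}` and `μ_v^{σ_Λ, u ← c'}`.
(The supremum is over a finite set, which is nonempty for feasible `σ_Λ`.) -/
noncomputable def influenceMatrix (μ : (V → Spin) → ℝ) (Λ : Finset V) (σ : Λ → Spin) :
    Matrix {v : V // v ∉ Λ} {v : V // v ∉ Λ} ℝ :=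
  Matrix.of fun u v =>
    if u = v then 0
    else
      ⨆ p : {c : Spin // 0 < vertexMarginal (pin μ Λ σ) u c} ×
          {c : Spin // 0 < vertexMarginal (pin μ Λ σ) u c},
        tvDist (vertexMarginal (pinVertex (pin μ Λ σ) u p.1) v)
          (vertexMarginal (pinVertex (pin μ Λ σ) u p.2) v)

/-- `μ` is `η`-spectrally independent: for each `Λ` and each feasible `σ_Λ`, the spectral radius
(maximum modulus of the complex eigenvalues) of the influence matrix is at most `η`. -/
def SpectrallyIndependent (μ : (V → Spin) → ℝ) (η : ℝ) : Prop :=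
  ∀ (Λ : Finset V) (σ : Λ → Spin), 0 < marginal μ Λ σ →
    spectralRadius ℂ ((influenceMatrix μ Λ σ).map (algebraMap ℝ ℂ)) ≤ ENNReal.ofReal η

/-- The distribution obtained from `μ` by imposing the local fields `φ`:
`π(σ) ∝ μ(σ) ∏_{v : σ_v = +1} φ_v`. -/
noncomputable def magnetize (μ : (V → Spin) → ℝ) (φ : V → ℝ) (σ : V → Spin) : ℝ :=
  (μ σ * ∏ v ∈ univ.filter (fun v => σ v = 1), φ v) /
    ∑ τ : V → Spin, μ τ * ∏ v ∈ univ.filter (fun v => τ v = 1), φ v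

/-- Complete `η`-spectral independence: spectral independence under all fields in `(0,1]^V`. -/
def CompletelySpectrallyIndependent (μ : (V → Spin) → ℝ) (η : ℝ) : Prop :=
  ∀ φ : V → ℝ, (∀ v, 0 < φ v ∧ φ v ≤ 1) → SpectrallyIndependent (magnetize μ φ) η

/-- The configuration `Y` on `V × [k]` built from a configuration `X` on `V` and chosen indices
`i`: `Y_(v,j) = +1` exactly when `X_v = +1` and `j = i v`. -/
def spread {k : ℕ} (X : V → Spin) (i : V → Fin k) : V × Fin k → Spin :=
  fun p => if X p.1 = 1 ∧ p.2 = i p.1 then 1 else -1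

/-- The `k`-transformation of `μ`: the law of `spread X i`, where `X ∼ μ` and, independently,
`i` is uniform on `V → Fin k` (equivalently, the `i v` are independent and uniform on `Fin k`;
`i v` is ignored when `X v = -1`). -/
noncomputable def kTransform (μ : (V → Spin) → ℝ) (k : ℕ) (Y : V × Fin k → Spin) : ℝ :=
  ∑ X : V → Spin, ∑ i : V → Fin k,
    if spread X i = Y then μ X * (1 / (Fintype.card (V → Fin k) : ℝ)) else 0

/-- The support `Ω(μ)`, as a type. -/
abbrev Omega (μ : (V → Spin) → ℝ) : Type _ := {σ : V → Spin // 0 < μ σ}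

/-- The transition matrix on `Ω(μ)` of the heat-bath uniform `ℓ`-block dynamics: choose
`S ⊆ V` with `|S| = ℓ` uniformly at random, keep the configuration on `V \ S` and resample the
configuration on `S` from `μ` conditioned on that on `V \ S`. -/
noncomputable def blockDynamics (μ : (V → Spin) → ℝ) (ℓ : ℕ) : Matrix (Omega μ) (Omega μ) ℝ :=
  Matrix.of fun σ τ =>
    (1 / ((univ.powersetCard ℓ : Finset (Finset V)).card : ℝ)) *
      ∑ S ∈ (univ.powersetCard ℓ : Finset (Finset V)), pin μ Sᶜ (fun v => σ.1 v) τ.1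

end Distributions

/-- The spectral gap `1 - λ₂` of a transition matrix all of whose eigenvalues are real (e.g. a
reversible one), where `λ₁ ≥ λ₂ ≥ ⋯` are the eigenvalues listed with multiplicity; by convention
`λ₂ = 0` if the state space has a single element. -/
noncomputable def spectralGap {Ω : Type*} [Fintype Ω] [DecidableEq Ω] (P : Matrix Ω Ω ℝ) : ℝ :=
  1 - (P.charpoly.roots.sort (· ≥ ·)).getD 1 0

end BlockDynamics

set_option linter.unusedSectionVars false

/-! The gap of a reversible chain follows from a Poincaré inequality. With `N = kn` sites, the
Dirichlet form of the `ℓ`-block dynamics is the average, over sets `Λ` of `N - ℓ` sites, of the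
expected conditional variance of `f` given the configuration on `Λ`. It must therefore be shown that
revealing `N - ℓ` random sites leaves a good part of `Var f`.

Local to global: revealing one site `p` lowers the variance, in expectation, by `Cov(f, 1_p)² /
Var(1_p)`, where `1_p` indicates spin `+1` at `p`. Suppose that under every pinning `Var(∑ c_p 1_p)
≤ C ∑ c_p² Var(1_p)`. Then Cauchy–Schwarz bounds the sum of these losses over all `p` by `C Var f`
(`sum_covar_sq_div_le`), so a random one of `m` unrevealed sites keeps a fraction at least `1 - C/m`
(`le_sum_condVariance_insert`). Since `1 - C/m ≥ ((m-1)/m)^(2C)` for `m ≥ 2C`, the product over `m =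
ℓ+1, …, N` telescopes to `(ℓ/N)^(2C)`.

The covariance bound holds for `μ_k` with `C = η + 2` (`covar_kTransform_le`). Under a pinning of
`μ_k`, the vertex spins follow `μ` reweighted site by site, each factor favouring `-1` or forbidding
a spin. This is a pinning of some `μ^(φ)` with `φ ≤ 1`, which is where complete spectral
independence enters. Given the spins, the indices at `+1` vertices are independent and uniform on
the compliant ones. Hence covariances between copies of distinct vertices factor through those of
the vertices and contribute `η`, while the mutually exclusive copies of one vertex contribute `2`.

For two spins the influence is `|Cov(1_u, 1_v)| / Var(1_u)`. This matrix has the nonzero spectrum of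
a symmetric one, so its spectral radius controls the covariance form
(`sum_mul_le_of_spectralRadius_le`). -/

namespace BlockDynamics

open Finset

/-! ### Spectral gap from a Poincaré inequality -/

section SpectralGap

open Matrix

variable {Ω : Type*} [Fintype Ω] [DecidableEq Ω]

/-- A matrix that is reversible with respect to `ν` is similar to a symmetric one. -/
lemma charpoly_symmetrization (P : Matrix Ω Ω ℝ) (ν : Ω → ℝ) (hν : ∀ x, 0 < ν x) :
    (Matrix.of fun x y => √(ν x) * P x y / √(ν y)).charpoly = P.charpoly := by
  have hs : ∀ x, √(ν x) ≠ 0 := fun x => (Real.sqrt_pos.2 (hν x)).ne'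
  let D : (Matrix Ω Ω ℝ)ˣ :=
    ⟨diagonal fun x => √(ν x), diagonal fun x => (√(ν x))⁻¹, by
      rw [diagonal_mul_diagonal]; simp [hs], by rw [diagonal_mul_diagonal]; simp [hs]⟩
  rw [← charpoly_units_conj D P, ← Matrix.coe_units_inv]
  congr 1
  ext x y
  simp [D, Units.inv_mk, div_eq_mul_inv]

/-- A Poincaré inequality for a reversible matrix bounds its spectral gap from below. -/
lemma le_spectralGap_of_poincare (P : Matrix Ω Ω ℝ) (ν : Ω → ℝ) (hν : ∀ x, 0 < ν x)
    (hrev : ∀ x y, ν x * P x y = ν y * P y x) (κ : ℝ) (hκ : κ ≤ 1)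
    (h : ∀ f : Ω → ℝ, ∑ x, ν x * f x = 0 →
      κ * ∑ x, ν x * f x ^ 2 ≤ ∑ x, ν x * f x ^ 2 - ∑ x, ∑ y, ν x * f x * P x y * f y) :
    κ ≤ spectralGap P := by
  set M : Matrix Ω Ω ℝ := Matrix.of fun x y => √(ν x) * P x y / √(ν y) with hM
  have hs : ∀ x, 0 < √(ν x) := fun x => Real.sqrt_pos.2 (hν x)
  have hsq : ∀ x, √(ν x) * √(ν x) = ν x := fun x => Real.mul_self_sqrt (hν x).le
  have hH : M.IsHermitian := by
    ext x y
    simp only [hM, conjTranspose_apply, of_apply, star_trivial]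
    rw [div_eq_div_iff (hs x).ne' (hs y).ne']
    linear_combination (-P x y) * hsq x + P y x * hsq y - hrev x y
  have hsort : P.charpoly.roots.sort (· ≥ ·) = List.ofFn hH.eigenvalues₀ := by
    rw [← charpoly_symmetrization P ν hν, ← hH.sort_roots_charpoly_eq_eigenvalues₀]
    simp [hM]
  rw [spectralGap, hsort]
  by_cases hcard : Fintype.card Ω ≤ 1
  -- With no second eigenvalue the default `0` makes the gap `1`; this is where `κ ≤ 1` is needed.
  · rw [List.getD_eq_default _ _ (by simpa using hcard)]
    simpa using hκ
  push Not at hcard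
  rw [List.getD_eq_getElem _ _ (by simpa using hcard), List.getElem_ofFn]
  set i₀ : Fin (Fintype.card Ω) := ⟨0, by omega⟩
  set i₁ : Fin (Fintype.card Ω) := ⟨1, hcard⟩
  set lam := hH.eigenvalues₀ i₁ with hlam
  let e := Fintype.equivOfCardEq (α := Fin (Fintype.card Ω)) (β := Ω) (Fintype.card_fin _)
  have hev : ∀ i, hH.eigenvalues (e i) = hH.eigenvalues₀ i := fun i => by
    simp [IsHermitian.eigenvalues, e]
  have hl0 : lam ≤ hH.eigenvalues (e i₀) := by
    rw [hev]; exact hH.eigenvalues₀_antitone (by simp [i₀, i₁, Fin.le_def])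
  have hl1 : hH.eigenvalues (e i₁) = lam := hev i₁
  have hne : e i₀ ≠ e i₁ := fun h => by simpa [i₀, i₁] using e.injective h
  have horth : ∀ i j, ⇑(hH.eigenvectorBasis i) ⬝ᵥ ⇑(hH.eigenvectorBasis j)
      = if i = j then 1 else 0 := fun i j => by
    have := orthonormal_iff_ite.1 hH.eigenvectorBasis.orthonormal i j
    rw [← this, EuclideanSpace.inner_eq_star_dotProduct, dotProduct_comm]
    simp
  set b₀ : Ω → ℝ := ⇑(hH.eigenvectorBasis (e i₀))
  set b₁ : Ω → ℝ := ⇑(hH.eigenvectorBasis (e i₁))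
  have h00 : b₀ ⬝ᵥ b₀ = 1 := by simpa using horth (e i₀) (e i₀)
  have h11 : b₁ ⬝ᵥ b₁ = 1 := by simpa using horth (e i₁) (e i₁)
  have h01 : b₀ ⬝ᵥ b₁ = 0 := by simpa [hne] using horth (e i₀) (e i₁)
  have h10 : b₁ ⬝ᵥ b₀ = 0 := by rw [dotProduct_comm, h01]
  have hM0 : M *ᵥ b₀ = hH.eigenvalues (e i₀) • b₀ := hH.mulVec_eigenvectorBasis _
  have hM1 : M *ᵥ b₁ = lam • b₁ := by rw [← hl1]; exact hH.mulVec_eigenvectorBasis _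
  -- The span of the top two eigenvectors contains a nonzero vector orthogonal to `√ν`. Its Rayleigh
  -- quotient is at least `lam`, and dividing it by `√ν` gives a test function of mean zero. Thus
  -- `√ν` need not be identified as the top eigenvector.
  obtain ⟨α, β, hαβ, hzero⟩ : ∃ α β : ℝ, 0 < α ^ 2 + β ^ 2 ∧
      α * ((fun x => √(ν x)) ⬝ᵥ b₀) + β * ((fun x => √(ν x)) ⬝ᵥ b₁) = 0 := by
    by_cases h0 : (fun x => √(ν x)) ⬝ᵥ b₀ = 0
    · exact ⟨1, 0, by norm_num, by simp [h0]⟩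
    · refine ⟨-((fun x => √(ν x)) ⬝ᵥ b₁), (fun x => √(ν x)) ⬝ᵥ b₀, ?_, by ring⟩
      have := sq_pos_of_ne_zero h0
      positivity
  set x : Ω → ℝ := α • b₀ + β • b₁ with hx
  have hxx : x ⬝ᵥ x = α ^ 2 + β ^ 2 := by
    simp only [hx, dotProduct_add, add_dotProduct, smul_dotProduct, dotProduct_smul, h00, h01,
      h10, h11, smul_eq_mul]
    ring
  have hxMx : lam * (α ^ 2 + β ^ 2) ≤ x ⬝ᵥ (M *ᵥ x) := by
    simp only [hx, mulVec_add, mulVec_smul, hM0, hM1, dotProduct_add, add_dotProduct,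
      smul_dotProduct, dotProduct_smul, h00, h01, h10, h11, smul_eq_mul]
    nlinarith [mul_le_mul_of_nonneg_left hl0 (sq_nonneg α)]
  have key := h (fun y => x y / √(ν y)) (by
    rw [← hzero]
    have : ∀ y, ν y * (x y / √(ν y)) = √(ν y) * x y := fun y => by
      rw [← mul_div_assoc, div_eq_iff (hs y).ne']; linear_combination (-x y) * hsq y
    simp only [this]
    change (fun y => √(ν y)) ⬝ᵥ x = _
    simp [hx, dotProduct_add, dotProduct_smul])
  have e1 : ∑ y, ν y * (x y / √(ν y)) ^ 2 = x ⬝ᵥ x := by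
    refine Finset.sum_congr rfl fun y _ => ?_
    rw [div_pow, Real.sq_sqrt (hν y).le, mul_div_cancel₀ _ (hν y).ne', sq]
  have e2 : ∑ a, ∑ y, ν a * (x a / √(ν a)) * P a y * (x y / √(ν y)) = x ⬝ᵥ (M *ᵥ x) := by
    simp only [dotProduct, mulVec, Finset.mul_sum]
    refine Finset.sum_congr rfl fun a _ => Finset.sum_congr rfl fun y _ => ?_
    simp only [hM, of_apply]
    have := (hs a).ne'
    have := (hs y).ne'
    field_simp
    rw [Real.sq_sqrt (hν a).le]
    ring
  rw [e1, e2, hxx] at key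
  have : κ * (α ^ 2 + β ^ 2) ≤ (1 - lam) * (α ^ 2 + β ^ 2) := by linarith
  exact le_of_mul_le_mul_right this hαβ

end SpectralGap

/-! ### Covariances and Cauchy–Schwarz -/

section Moments

variable {α : Type*} [Fintype α]

/-- The expectation of `f` with respect to the weight `w`. -/
noncomputable def expect (w f : α → ℝ) : ℝ := ∑ a, w a * f a

/-- The covariance of `f` and `g` with respect to the weight `w`. -/
noncomputable def covar (w f g : α → ℝ) : ℝ :=
  expect w (fun a => f a * g a) - expect w f * expect w g

lemma expect_add (w f g : α → ℝ) :
    expect w (fun a => f a + g a) = expect w f + expect w g := by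
  simp [expect, mul_add, sum_add_distrib]

lemma expect_smul (w f : α → ℝ) (c : ℝ) :
    expect w (fun a => c * f a) = c * expect w f := by
  simp only [expect, mul_sum]
  exact sum_congr rfl fun a _ => by ring

lemma expect_sum {ι : Type*} (s : Finset ι) (w : α → ℝ) (f : ι → α → ℝ) :
    expect w (fun a => ∑ i ∈ s, f i a) = ∑ i ∈ s, expect w (f i) := by
  simp only [expect, mul_sum]
  exact sum_comm

lemma expect_const {w : α → ℝ} (hw : w ∈ stdSimplex ℝ α) (c : ℝ) :
    expect w (fun _ => c) = c := by
  rw [expect, ← sum_mul, hw.2, one_mul]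

lemma expect_nonneg {w f : α → ℝ} (hw : ∀ a, 0 ≤ w a) (hf : ∀ a, 0 ≤ f a) : 0 ≤ expect w f :=
  sum_nonneg fun a _ => mul_nonneg (hw a) (hf a)

lemma expect_mono {w f g : α → ℝ} (hw : ∀ a, 0 ≤ w a) (h : ∀ a, f a ≤ g a) :
    expect w f ≤ expect w g :=
  sum_le_sum fun a _ => mul_le_mul_of_nonneg_left (h a) (hw a)

lemma covar_comm (w f g : α → ℝ) : covar w f g = covar w g f := by
  simp only [covar, mul_comm]

lemma covar_smul_right (w f g : α → ℝ) (c : ℝ) :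
    covar w f (fun a => c * g a) = c * covar w f g := by
  have : (fun a => f a * (c * g a)) = fun a => c * (f a * g a) := by ext; ring
  rw [covar, covar, this, expect_smul, expect_smul]
  ring

lemma covar_sum_right {ι : Type*} (s : Finset ι) (w f : α → ℝ) (g : ι → α → ℝ) :
    covar w f (fun a => ∑ i ∈ s, g i a) = ∑ i ∈ s, covar w f (g i) := by
  simp only [covar, mul_sum, expect_sum, sum_sub_distrib]

lemma covar_linear_combination_right {ι : Type*} (s : Finset ι) (w f : α → ℝ) (c : ι → ℝ)
    (g : ι → α → ℝ) :
    covar w f (fun a => ∑ i ∈ s, c i * g i a) = ∑ i ∈ s, c i * covar w f (g i) := by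
  rw [covar_sum_right]
  exact sum_congr rfl fun i _ => covar_smul_right w f (g i) (c i)

lemma covar_linear_combination {ι : Type*} (s : Finset ι) (w : α → ℝ) (c : ι → ℝ)
    (g : ι → α → ℝ) :
    covar w (fun a => ∑ i ∈ s, c i * g i a) (fun a => ∑ i ∈ s, c i * g i a) =
      ∑ i ∈ s, ∑ j ∈ s, c i * c j * covar w (g i) (g j) := by
  rw [covar_linear_combination_right]
  refine sum_congr rfl fun i _ => ?_
  rw [covar_comm, covar_linear_combination_right, mul_sum]
  exact sum_congr rfl fun j _ => by ring

/-- The covariance as a mean of a product of centered functions. -/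
lemma covar_eq_expect_centered {w : α → ℝ} (hw : w ∈ stdSimplex ℝ α) (f g : α → ℝ) :
    covar w f g = expect w (fun a => (f a - expect w f) * (g a - expect w g)) := by
  have : (fun a => (f a - expect w f) * (g a - expect w g)) = fun a =>
      ((f a * g a + (-expect w g) * f a) + (-expect w f) * g a) + expect w f * expect w g := by
    ext; ring
  rw [this, expect_add, expect_add, expect_add, expect_smul, expect_smul, expect_const hw, covar]
  ring

lemma covar_self_nonneg {w : α → ℝ} (hw : w ∈ stdSimplex ℝ α) (f : α → ℝ) :
    0 ≤ covar w f f := by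
  rw [covar_eq_expect_centered hw]
  exact expect_nonneg hw.1 fun a => mul_self_nonneg _

lemma covar_sq_le {w : α → ℝ} (hw : w ∈ stdSimplex ℝ α) (f g : α → ℝ) :
    covar w f g ^ 2 ≤ covar w f f * covar w g g := by
  simp only [covar_eq_expect_centered hw, expect]
  refine sum_sq_le_sum_mul_sum_of_sq_le_mul univ (fun a _ => ?_) (fun a _ => ?_) fun a _ => ?_
  · exact mul_nonneg (hw.1 a) (mul_self_nonneg _)
  · exact mul_nonneg (hw.1 a) (mul_self_nonneg _)
  · exact le_of_eq (by ring)

/-- If the variance of a linear combination of the `g i` is at most `C` times the value it would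
have for uncorrelated `g i`, then the variance of `f` dominates, up to the factor `C`, the sum of
the variances explained by the single `g i`. -/
lemma sum_covar_sq_div_le {ι : Type*} [Fintype ι] {w : α → ℝ} (hw : w ∈ stdSimplex ℝ α)
    (g : ι → α → ℝ) {C : ℝ} (hC : 0 ≤ C)
    (h : ∀ c : ι → ℝ, covar w (fun a => ∑ i, c i * g i a) (fun a => ∑ i, c i * g i a) ≤
      C * ∑ i, c i ^ 2 * covar w (g i) (g i)) (f : α → ℝ) :
    ∑ i, covar w f (g i) ^ 2 / covar w (g i) (g i) ≤ C * covar w f f := by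
  set B := ∑ i, covar w f (g i) ^ 2 / covar w (g i) (g i) with hB
  -- With these regression coefficients both `Cov(f, ∑ c_i g_i)` and `∑ c_i² Var(g_i)` equal `B`, so
  -- Cauchy–Schwarz gives `B² ≤ C B Var f`. Where `Var(g_i) = 0`, the convention `x / 0 = 0` removes
  -- the term.
  set c : ι → ℝ := fun i => covar w f (g i) / covar w (g i) (g i) with hc
  have hB0 : 0 ≤ B := sum_nonneg fun i _ => div_nonneg (sq_nonneg _) (covar_self_nonneg hw _)
  have h1 : covar w f (fun a => ∑ i, c i * g i a) = B := by
    rw [covar_linear_combination_right]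
    exact sum_congr rfl fun i _ => by simp only [hc]; ring
  have h2 : ∑ i, c i ^ 2 * covar w (g i) (g i) = B := by
    refine sum_congr rfl fun i _ => ?_
    by_cases h0 : covar w (g i) (g i) = 0
    · simp [h0]
    · simp only [hc]; field_simp
  have h3 := covar_sq_le hw f (fun a => ∑ i, c i * g i a)
  have h4 := h c
  rw [h1] at h3
  rw [h2] at h4
  have hv := covar_self_nonneg hw f
  rcases hB0.eq_or_lt with h0 | h0
  · rw [← h0]; positivity
  · have : B * B ≤ (C * covar w f f) * B := by nlinarith [mul_le_mul_of_nonneg_left h4 hv]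
    exact le_of_mul_le_mul_right this h0

end Moments

/-! ### Quadratic forms and spectral radius -/

section QuadraticForm

open Matrix

variable {ι : Type*} [Fintype ι] [DecidableEq ι]

lemma IsHermitian.dotProduct_mulVec_le {S : Matrix ι ι ℝ} (hS : S.IsHermitian) {η : ℝ}
    (h : ∀ (lam : ℝ) (y : ι → ℝ), y ≠ 0 → S *ᵥ y = lam • y → lam ≤ η) (x : ι → ℝ) :
    x ⬝ᵥ (S *ᵥ x) ≤ η * (x ⬝ᵥ x) := by
  have hH : (η • (1 : Matrix ι ι ℝ) - S).IsHermitian :=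
    (isHermitian_one.smul (by simp [IsSelfAdjoint])).sub hS
  have hp : (η • (1 : Matrix ι ι ℝ) - S).PosSemidef := by
    rw [hH.posSemidef_iff_eigenvalues_nonneg]
    intro i
    have hm := hH.mulVec_eigenvectorBasis i
    have hy : (⇑(hH.eigenvectorBasis i) : ι → ℝ) ≠ 0 := fun h0 =>
      hH.eigenvectorBasis.orthonormal.ne_zero i (by ext j; exact congrFun h0 j)
    have := h (η - hH.eigenvalues i) _ hy (by
      rw [sub_mulVec, smul_mulVec, one_mulVec] at hm
      rw [sub_smul, ← hm]; abel)
    simpa using this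
  have := hp.dotProduct_mulVec_nonneg x
  simp only [star_trivial, sub_mulVec, smul_mulVec, one_mulVec, dotProduct_sub, dotProduct_smul,
    smul_eq_mul] at this
  linarith

/-- The quadratic form of a symmetric matrix `K` is bounded relative to the diagonal form `d` by
the spectral radius of the matrix with entries `|K u v| / d u`. -/
lemma sum_mul_le_of_spectralRadius_le (K : ι → ι → ℝ) (hK : ∀ u v, K u v = K v u) (d : ι → ℝ)
    (hd : ∀ u, 0 ≤ d u) (hKd : ∀ u v, d u = 0 → K u v = 0) {η : ℝ} (hη : 0 ≤ η)
    (A : Matrix ι ι ℝ) (hA : ∀ u v, A u v = |K u v| / d u)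
    (hr : spectralRadius ℂ (A.map (algebraMap ℝ ℂ)) ≤ ENNReal.ofReal η) (x : ι → ℝ) :
    ∑ u, ∑ v, x u * x v * K u v ≤ η * ∑ u, x u ^ 2 * d u := by
  have hsq : ∀ u, √(d u) * √(d u) = d u := fun u => Real.mul_self_sqrt (hd u)
  let S : Matrix ι ι ℝ := Matrix.of fun u v => |K u v| / (√(d u) * √(d v))
  have hS : S.IsHermitian := by
    ext u v
    simp [S, hK v u, mul_comm]
  -- An eigenvector `y` of `S` with positive eigenvalue vanishes where `d` does, so `y / √d` is a
  -- nonzero eigenvector of `A` for the same eigenvalue, and the spectral radius applies.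
  have hev : ∀ (lam : ℝ) (y : ι → ℝ), y ≠ 0 → S *ᵥ y = lam • y → lam ≤ η := by
    intro lam y hy hlam
    rcases le_or_gt lam 0 with h0 | h0
    · exact h0.trans hη
    have hyd : ∀ u, d u = 0 → y u = 0 := fun u hu => by
      have := congrFun hlam u
      have h1 : (S *ᵥ y) u = 0 := sum_eq_zero fun v _ => by simp [S, hu]
      rw [h1, Pi.smul_apply, smul_eq_mul] at this
      exact (mul_eq_zero.1 this.symm).resolve_left h0.ne'
    let z : ι → ℝ := fun u => y u / √(d u)
    have hz : z ≠ 0 := by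
      obtain ⟨u, hu⟩ := Function.ne_iff.1 hy
      refine Function.ne_iff.2 ⟨u, ?_⟩
      have : d u ≠ 0 := fun h => hu (hyd u h)
      exact div_ne_zero hu (Real.sqrt_ne_zero'.2 ((hd u).lt_of_ne' this))
    have hAz : A *ᵥ z = lam • z := by
      ext u
      have h1 := congrFun hlam u
      simp only [mulVec, dotProduct, Pi.smul_apply, smul_eq_mul, S, of_apply, z, hA] at h1 ⊢
      rw [← mul_div_assoc, ← h1, sum_div]
      refine sum_congr rfl fun v _ => ?_
      have hinv : (d u)⁻¹ = (√(d u))⁻¹ * (√(d u))⁻¹ := by rw [← mul_inv, hsq]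
      simp only [div_eq_mul_inv, mul_inv, hinv]
      ring
    have hspec : (lam : ℂ) ∈ spectrum ℂ (A.map (algebraMap ℝ ℂ)) := by
      rw [← Matrix.spectrum_toLin']
      refine Module.End.HasEigenvalue.mem_spectrum
        (Module.End.hasEigenvalue_of_hasEigenvector (x := fun u => (z u : ℂ)) ?_)
      rw [Module.End.hasEigenvector_iff, Module.End.mem_eigenspace_iff]
      refine ⟨?_, ?_⟩
      · rw [toLin'_apply]
        ext u
        have h1 := congrArg (fun r : ℝ => (r : ℂ)) (congrFun hAz u)
        simpa [mulVec, dotProduct] using h1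
      · intro h
        apply hz
        ext u
        simpa using congrFun h u
    have h2 : (‖(lam : ℂ)‖₊ : ENNReal) ≤ ENNReal.ofReal η :=
      (le_iSup₂ (f := fun (k : ℂ) (_ : k ∈ spectrum ℂ (A.map (algebraMap ℝ ℂ))) =>
        (‖k‖₊ : ENNReal)) (lam : ℂ) hspec).trans hr
    rw [← enorm_eq_nnnorm, ← ofReal_norm, ENNReal.ofReal_le_ofReal_iff hη] at h2
    simpa [abs_of_pos h0] using h2
  -- Absolute values in the test vector dominate the signed form, as `S` has the entries `|K u v|`.
  have h1 := IsHermitian.dotProduct_mulVec_le hS hev (fun u => |x u| * √(d u))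
  have h2 : (fun u => |x u| * √(d u)) ⬝ᵥ (fun u => |x u| * √(d u)) = ∑ u, x u ^ 2 * d u := by
    refine sum_congr rfl fun u _ => ?_
    rw [← hsq u, ← sq_abs (x u)]; ring
  have h3 : ∑ u, ∑ v, x u * x v * K u v ≤
      (fun u => |x u| * √(d u)) ⬝ᵥ (S *ᵥ (fun u => |x u| * √(d u))) := by
    simp only [dotProduct, mulVec, mul_sum]
    refine sum_le_sum fun u _ => sum_le_sum fun v _ => ?_
    have : |x u| * √(d u) * (S u v * (|x v| * √(d v))) = |x u * x v * K u v| := by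
      simp only [S, of_apply, abs_mul]
      by_cases hu : d u = 0
      · simp [hu, hKd u v hu]
      by_cases hv : d v = 0
      · simp [hv, hK u v, hKd v u hv]
      have := Real.sqrt_ne_zero'.2 ((hd u).lt_of_ne' hu)
      have := Real.sqrt_ne_zero'.2 ((hd v).lt_of_ne' hv)
      field_simp
    rw [this]
    exact le_abs_self _
  rw [h2] at h1
  exact h3.trans h1

end QuadraticForm

lemma sum_subtype_eq_sum {α : Type*} [Fintype α] (p : α → Prop) [Fintype {a // p a}] (F : α → ℝ)
    (h : ∀ a, ¬ p a → F a = 0) : ∑ a : {a // p a}, F a = ∑ a, F a := by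
  classical
  rw [← sum_subtype (univ.filter p) (by simp) F]
  exact sum_filter_of_ne fun a _ ha => by_contra fun hp => ha (h a hp)

/-- The covariance with a function that is constant on the support vanishes. -/
lemma covar_eq_zero_of_eq_on_support {α : Type*} [Fintype α] {w : α → ℝ}
    (hw : w ∈ stdSimplex ℝ α) (f g : α → ℝ) (c : ℝ) (h : ∀ a, w a ≠ 0 → f a = c) :
    covar w f g = 0 := by
  have h1 : ∀ g' : α → ℝ, expect w (fun a => f a * g' a) = c * expect w g' := fun g' => by
    rw [← expect_smul]
    refine sum_congr rfl fun a _ => ?_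
    by_cases h0 : w a = 0
    · simp [h0]
    · simp only [h a h0]
  have h2 := h1 fun _ => 1
  simp only [mul_one, expect_const hw] at h2
  rw [covar, h1, h2]
  ring

/-! ### Influence matrix as normalized covariance -/

section Influence

variable {V : Type*} [Fintype V] [DecidableEq V]

/-- The indicator of the event that `u` has spin `+1`. -/
def plus (u : V) (τ : V → Spin) : ℝ := if τ u = 1 then 1 else 0

lemma condOn_mem_stdSimplex {μ : (V → Spin) → ℝ} (hμ : ∀ τ, 0 ≤ μ τ) {E : Finset (V → Spin)}
    (hE : 0 < ∑ τ ∈ E, μ τ) : condOn μ E ∈ stdSimplex ℝ (V → Spin) := by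
  refine ⟨fun τ => ?_, ?_⟩
  · unfold condOn
    split_ifs
    · exact div_nonneg (hμ τ) hE.le
    · exact le_rfl
  · simp only [condOn]
    rw [← sum_filter, filter_mem_eq_inter, univ_inter, ← sum_div, div_self hE.ne']

/-- The weight of the event that `u` has spin `c` and `v` has spin `c'`. -/
noncomputable def joint (w : (V → Spin) → ℝ) (u v : V) (c c' : Spin) : ℝ :=
  ∑ τ : V → Spin, if τ u = c ∧ τ v = c' then w τ else 0

lemma sum_spin (F : Spin → ℝ) : ∑ c : Spin, F c = F 1 + F (-1) := by
  rw [UnitsInt.univ, sum_pair (by decide)]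

lemma vertexMarginal_pinVertex (w : (V → Spin) → ℝ) (u v : V) (c c' : Spin) :
    vertexMarginal (pinVertex w u c) v c' = joint w u v c c' / vertexMarginal w u c := by
  simp only [vertexMarginal, pinVertex, condOn, joint, sum_div, sum_filter, mem_filter, mem_univ,
    true_and]
  refine sum_congr rfl fun τ _ => ?_
  by_cases h1 : τ u = c <;> by_cases h2 : τ v = c' <;> simp [h1, h2]

lemma spin_ne_one_iff (s : Spin) : s ≠ 1 ↔ s = -1 :=
  ⟨fun h => (Int.units_eq_one_or s).resolve_left h, fun h => by rw [h]; decide⟩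

lemma joint_add_joint_right (w : (V → Spin) → ℝ) (u v : V) (c : Spin) :
    joint w u v c 1 + joint w u v c (-1) = vertexMarginal w u c := by
  simp only [joint, vertexMarginal, sum_filter, ← sum_add_distrib]
  refine sum_congr rfl fun τ _ => ?_
  rcases Int.units_eq_one_or (τ v) with h | h <;> simp [h, show (-1 : Spin) ≠ 1 by decide,
    show (1 : Spin) ≠ -1 by decide]

lemma joint_comm (w : (V → Spin) → ℝ) (u v : V) (c c' : Spin) :
    joint w u v c c' = joint w v u c' c := by
  simp only [joint, and_comm]

lemma vertexMarginal_add {w : (V → Spin) → ℝ} (hw : w ∈ stdSimplex ℝ (V → Spin)) (u : V) :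
    vertexMarginal w u 1 + vertexMarginal w u (-1) = 1 := by
  rw [← hw.2]
  simp only [vertexMarginal, sum_filter, ← sum_add_distrib]
  refine sum_congr rfl fun τ _ => ?_
  rcases Int.units_eq_one_or (τ u) with h | h <;> simp [h, show (-1 : Spin) ≠ 1 by decide,
    show (1 : Spin) ≠ -1 by decide]

lemma expect_plus (w : (V → Spin) → ℝ) (u : V) : expect w (plus u) = vertexMarginal w u 1 := by
  simp [expect, plus, vertexMarginal, sum_filter]

lemma expect_plus_mul_plus (w : (V → Spin) → ℝ) (u v : V) :
    expect w (fun τ => plus u τ * plus v τ) = joint w u v 1 1 := by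
  refine sum_congr rfl fun τ _ => ?_
  by_cases h1 : τ u = 1 <;> by_cases h2 : τ v = 1 <;> simp [plus, h1, h2]

lemma covar_plus (w : (V → Spin) → ℝ) (u v : V) :
    covar w (plus u) (plus v) =
      joint w u v 1 1 - vertexMarginal w u 1 * vertexMarginal w v 1 := by
  rw [covar, expect_plus_mul_plus, expect_plus, expect_plus]

lemma covar_plus_self {w : (V → Spin) → ℝ} (hw : w ∈ stdSimplex ℝ (V → Spin)) (u : V) :
    covar w (plus u) (plus u) = vertexMarginal w u 1 * vertexMarginal w u (-1) := by
  have : joint w u u 1 1 = vertexMarginal w u 1 := by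
    simp [joint, vertexMarginal, sum_filter]
  rw [covar_plus, this]
  linear_combination (-vertexMarginal w u 1) * vertexMarginal_add hw u

lemma tvDist_self {α : Type*} [Fintype α] (p : α → ℝ) : tvDist p p = 0 := by simp [tvDist]

lemma tvDist_comm {α : Type*} [Fintype α] (p q : α → ℝ) : tvDist p q = tvDist q p := by
  simp only [tvDist, abs_sub_comm]

lemma tvDist_nonneg {α : Type*} [Fintype α] (p q : α → ℝ) : 0 ≤ tvDist p q :=
  mul_nonneg (by norm_num) (sum_nonneg fun _ _ => abs_nonneg _)

/-- With `p + q = 1` the two conditional marginals at `v` differ by `Cov / (p q)` at spin `+1` and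
by its negative at `-1`, and `p q` is the variance at `u`. -/
lemma tvDist_pinVertex {w : (V → Spin) → ℝ} (hw : w ∈ stdSimplex ℝ (V → Spin)) (u v : V)
    (h1 : 0 < vertexMarginal w u 1) (h2 : 0 < vertexMarginal w u (-1)) :
    tvDist (vertexMarginal (pinVertex w u 1) v) (vertexMarginal (pinVertex w u (-1)) v) =
      |covar w (plus u) (plus v)| / covar w (plus u) (plus u) := by
  have a1 := joint_add_joint_right w u v 1
  have a2 := joint_add_joint_right w u v (-1)
  have a3 := joint_add_joint_right w v u 1
  rw [joint_comm w v u 1 1, joint_comm w v u 1 (-1)] at a3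
  have hu := vertexMarginal_add hw u
  rw [tvDist, sum_spin]
  simp only [vertexMarginal_pinVertex, covar_plus_self hw]
  set p := vertexMarginal w u 1
  set q := vertexMarginal w u (-1)
  have e1 : joint w u v 1 1 / p - joint w u v (-1) 1 / q =
      covar w (plus u) (plus v) / (p * q) := by
    rw [covar_plus]
    field_simp
    rw [← a3]
    linear_combination joint w u v 1 1 * hu
  have e2 : joint w u v 1 (-1) / p - joint w u v (-1) (-1) / q =
      -(covar w (plus u) (plus v) / (p * q)) := by
    rw [← e1, ← sub_eq_zero]
    have b1 : joint w u v 1 (-1) / p = 1 - joint w u v 1 1 / p := by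
      rw [eq_sub_iff_add_eq, ← add_div, add_comm, a1, div_self h1.ne']
    have b2 : joint w u v (-1) (-1) / q = 1 - joint w u v (-1) 1 / q := by
      rw [eq_sub_iff_add_eq, ← add_div, add_comm, a2, div_self h2.ne']
    rw [b1, b2]
    ring
  rw [e1, e2, abs_neg, abs_div, abs_of_pos (mul_pos h1 h2)]
  ring

/-- The entries of the influence matrix in terms of covariances. -/
lemma influenceMatrix_apply (μ : (V → Spin) → ℝ) (Λ : Finset V) (σ : Λ → Spin)
    (hw : pin μ Λ σ ∈ stdSimplex ℝ (V → Spin)) {u v : {v : V // v ∉ Λ}} (huv : u ≠ v) :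
    influenceMatrix μ Λ σ u v =
      |covar (pin μ Λ σ) (plus u.1) (plus v.1)| / covar (pin μ Λ σ) (plus u.1) (plus u.1) := by
  simp only [influenceMatrix, Matrix.of_apply, if_neg huv]
  set w := pin μ Λ σ
  have hm : ∀ c, 0 ≤ vertexMarginal w u.1 c := fun c => sum_nonneg fun τ _ => hw.1 τ
  have hu := vertexMarginal_add hw u.1
  by_cases h : 0 < vertexMarginal w u.1 1 ∧ 0 < vertexMarginal w u.1 (-1)
  · obtain ⟨h1, h2⟩ := h
    have key := tvDist_pinVertex hw u.1 v.1 h1 h2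
    have : Nonempty ({c : Spin // 0 < vertexMarginal w u.1 c} ×
        {c : Spin // 0 < vertexMarginal w u.1 c}) := ⟨⟨1, h1⟩, ⟨1, h1⟩⟩
    rw [← key]
    refine le_antisymm (ciSup_le ?_) ?_
    · rintro ⟨⟨c, hc⟩, ⟨c', hc'⟩⟩
      rcases Int.units_eq_one_or c with rfl | rfl <;>
        rcases Int.units_eq_one_or c' with rfl | rfl
      · rw [tvDist_self]; exact tvDist_nonneg _ _
      · exact le_rfl
      · rw [tvDist_comm]
      · rw [tvDist_self]; exact tvDist_nonneg _ _
    · exact le_ciSup (f := fun p : {c : Spin // 0 < vertexMarginal w u.1 c} ×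
        {c : Spin // 0 < vertexMarginal w u.1 c} => tvDist (vertexMarginal (pinVertex w u.1 p.1) v.1)
          (vertexMarginal (pinVertex w u.1 p.2) v.1)) (Set.finite_range _).bddAbove
        (⟨1, h1⟩, ⟨-1, h2⟩)
  -- When `u` is deterministic the supremum only compares equal laws, and the right side is a
  -- division by zero; both are `0`.
  · have h0 : vertexMarginal w u.1 1 * vertexMarginal w u.1 (-1) = 0 := by
      by_contra hne
      exact h ⟨(hm 1).lt_of_ne' (left_ne_zero_of_mul hne),
        (hm (-1)).lt_of_ne' (right_ne_zero_of_mul hne)⟩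
    rw [covar_plus_self hw, h0, div_zero]
    have : ∀ p : {c : Spin // 0 < vertexMarginal w u.1 c} ×
        {c : Spin // 0 < vertexMarginal w u.1 c}, tvDist (vertexMarginal (pinVertex w u.1 p.1) v.1)
          (vertexMarginal (pinVertex w u.1 p.2) v.1) = 0 := by
      rintro ⟨⟨c, hc⟩, ⟨c', hc'⟩⟩
      rcases Int.units_eq_one_or c with rfl | rfl <;>
        rcases Int.units_eq_one_or c' with rfl | rfl
      · exact tvDist_self _
      · exact absurd ⟨hc, hc'⟩ h
      · exact absurd ⟨hc', hc⟩ h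
      · exact tvDist_self _
    simp [this]

/-- Spectral independence bounds the off-diagonal part of the covariance form of every
conditional distribution. -/
lemma SpectrallyIndependent.sum_covar_le {μ : (V → Spin) → ℝ} (hμ : ∀ τ, 0 ≤ μ τ) {η : ℝ}
    (hη : 0 ≤ η) (h : SpectrallyIndependent μ η) (Λ : Finset V) (σ : Λ → Spin)
    (hσ : 0 < marginal μ Λ σ) (x : V → ℝ) :
    ∑ u, ∑ v, (if u = v then 0 else x u * x v * covar (pin μ Λ σ) (plus u) (plus v)) ≤
      η * ∑ u, x u ^ 2 * covar (pin μ Λ σ) (plus u) (plus u) := by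
  have hw : pin μ Λ σ ∈ stdSimplex ℝ (V → Spin) := condOn_mem_stdSimplex hμ hσ
  set w := pin μ Λ σ
  -- Pinned vertices are deterministic, so sums over `V \ Λ` may be extended to `V`.
  have hzero : ∀ u v, u ∈ Λ → covar w (plus u) (plus v) = 0 := fun u v hu => by
    refine covar_eq_zero_of_eq_on_support hw _ _ (if σ ⟨u, hu⟩ = 1 then 1 else 0) fun τ hτ => ?_
    have hmem : τ ∈ agreeSet Λ σ := by
      by_contra hn
      exact hτ (if_neg hn)
    rw [plus, (mem_filter.1 hmem).2 ⟨u, hu⟩]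
  have key := sum_mul_le_of_spectralRadius_le
    (fun u v : {v : V // v ∉ Λ} => if u = v then 0 else covar w (plus u.1) (plus v.1))
    (fun u v => by simp only [eq_comm (a := u), covar_comm w (plus u.1)])
    (fun u => covar w (plus u.1) (plus u.1)) (fun u => covar_self_nonneg hw _)
    (fun u v hu => by
      have := covar_sq_le hw (plus u.1) (plus v.1)
      rw [hu, zero_mul] at this
      rw [pow_eq_zero_iff two_ne_zero |>.1 (le_antisymm this (sq_nonneg _)), ite_self])
    hη (influenceMatrix μ Λ σ)
    (fun u v => by
      by_cases huv : u = v
      · simp [huv, influenceMatrix]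
      · simp only [if_neg huv]; exact influenceMatrix_apply μ Λ σ hw huv)
    (h Λ σ hσ) (fun u => x u.1)
  rw [sum_subtype_eq_sum (fun v => v ∉ Λ) (fun u => x u ^ 2 * covar w (plus u) (plus u))
    (fun u hu => by rw [hzero u u (not_not.1 hu), mul_zero])] at key
  refine le_trans (le_of_eq ?_) key
  rw [← sum_subtype_eq_sum (fun v => v ∉ Λ) _ (fun u hu => sum_eq_zero fun v _ => by
    rw [hzero u v (not_not.1 hu), mul_zero, ite_self])]
  refine sum_congr rfl fun u _ => ?_
  rw [← sum_subtype_eq_sum (fun v => v ∉ Λ) _ (fun v hv => by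
    rw [covar_comm, hzero v u (not_not.1 hv), mul_zero, ite_self])]
  refine sum_congr rfl fun v _ => ?_
  by_cases huv : u = v
  · simp [huv]
  · simp [huv, Subtype.coe_injective.ne huv]

end Influence

/-! ### Single-site reweightings as pinned magnetizations -/

section Tilt

variable {V : Type*} [Fintype V] [DecidableEq V]

/-- A distribution that arises from `μ` by reweighting each spin separately, favouring `-1` or
forbidding a spin, is a pinning of a magnetization of `μ`. -/
lemma exists_pin_magnetize_eq {μ : (V → Spin) → ℝ} (hμ : ∀ τ, 0 ≤ μ τ) (a : V → Spin → ℝ)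
    (ha : ∀ v s, 0 ≤ a v s) (ha' : ∀ v, a v (-1) = 0 ∨ a v 1 ≤ a v (-1))
    (hZ : 0 < ∑ X, μ X * ∏ v, a v (X v)) :
    ∃ (φ : V → ℝ) (Λ : Finset V) (σ : Λ → Spin), (∀ v, 0 < φ v ∧ φ v ≤ 1) ∧
      (∀ τ, 0 ≤ magnetize μ φ τ) ∧ 0 < marginal (magnetize μ φ) Λ σ ∧
      pin (magnetize μ φ) Λ σ =
        fun X => (μ X * ∏ v, a v (X v)) / ∑ X, μ X * ∏ v, a v (X v) := by
  set W : (V → Spin) → ℝ := fun X => μ X * ∏ v, a v (X v) with hW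
  set Z := ∑ X, W X with hZdef
  obtain ⟨X₀, -, hX₀⟩ := exists_ne_zero_of_sum_ne_zero hZ.ne'
  have hμ₀ : 0 < μ X₀ := (hμ X₀).lt_of_ne' (left_ne_zero_of_mul hX₀)
  have ha₀ : ∀ v, a v (X₀ v) ≠ 0 := fun v => prod_ne_zero_iff.1 (right_ne_zero_of_mul hX₀) v
    (mem_univ v)
  have hex : ∀ v, a v 1 ≠ 0 ∨ a v (-1) ≠ 0 := fun v => by
    have := ha₀ v
    rcases Int.units_eq_one_or (X₀ v) with h | h <;> rw [h] at this
    · exact Or.inl this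
    · exact Or.inr this
  -- Vertices with a forbidden spin form `Λ` and are pinned to the allowed one, `s v`; elsewhere the
  -- field is the ratio of weights, at most `1` by `ha'`. The constant `K` collects what is factored
  -- out of the product.
  let s : V → Spin := fun v => if a v 1 = 0 then -1 else 1
  let Λ : Finset V := univ.filter fun v => a v 1 = 0 ∨ a v (-1) = 0
  have hΛ : ∀ v, v ∈ Λ ↔ (a v 1 = 0 ∨ a v (-1) = 0) := fun v => by simp [Λ]
  let φ : V → ℝ := fun v => if v ∈ Λ then 1 else a v 1 / a v (-1)
  have hφ : ∀ v, 0 < φ v ∧ φ v ≤ 1 := fun v => by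
    simp only [φ]
    split_ifs with h
    · exact ⟨one_pos, le_rfl⟩
    · rw [hΛ, not_or] at h
      have h1 := (ha v 1).lt_of_ne' h.1
      have h2 := (ha v (-1)).lt_of_ne' h.2
      exact ⟨div_pos h1 h2, (div_le_one h2).2 ((ha' v).resolve_left h.2)⟩
  set K : ℝ := ∏ v, if v ∈ Λ then a v (s v) else a v (-1) with hK
  have hKpos : 0 < K := prod_pos fun v _ => by
    split_ifs with h
    · by_cases h1 : a v 1 = 0
      · simp only [s, if_pos h1]
        exact (ha v _).lt_of_ne' ((hex v).resolve_left (not_not.2 h1))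
      · simp only [s, if_neg h1]
        exact (ha v _).lt_of_ne' h1
    · rw [hΛ, not_or] at h
      exact (ha v _).lt_of_ne' h.2
  set T : ℝ := ∑ τ : V → Spin, μ τ * ∏ v ∈ univ.filter (fun v => τ v = 1), φ v with hT
  have hTpos : 0 < T := by
    refine sum_pos' (fun τ _ => mul_nonneg (hμ τ) (prod_nonneg fun v _ => (hφ v).1.le))
      ⟨X₀, mem_univ _, mul_pos hμ₀ (prod_pos fun v _ => (hφ v).1)⟩
  have hin : ∀ X ∈ agreeSet Λ (fun v => s v), magnetize μ φ X = W X / (K * T) := by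
    intro X hX
    have hX' : ∀ v, v ∈ Λ → X v = s v := fun v hv => (mem_filter.1 hX).2 ⟨v, hv⟩
    have : ∏ v, a v (X v) = K * ∏ v ∈ univ.filter (fun v => X v = 1), φ v := by
      rw [prod_filter, hK, ← prod_mul_distrib]
      refine prod_congr rfl fun v _ => ?_
      by_cases hv : v ∈ Λ
      · simp [hv, φ, hX' v hv]
      · simp only [if_neg hv, φ]
        rw [hΛ, not_or] at hv
        rcases Int.units_eq_one_or (X v) with h | h
        · rw [h, if_pos rfl, mul_div_cancel₀ _ hv.2]
        · rw [h, if_neg (by decide), mul_one]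
    rw [magnetize, ← hT]
    change _ = μ X * (∏ v, a v (X v)) / (K * T)
    rw [this]
    field_simp
  have hout : ∀ X, X ∉ agreeSet Λ (fun v => s v) → W X = 0 := by
    intro X hX
    simp only [agreeSet, mem_filter, mem_univ, true_and, not_forall] at hX
    obtain ⟨⟨v, hv⟩, hne⟩ := hX
    refine mul_eq_zero_of_right _ (prod_eq_zero (mem_univ v) ?_)
    rw [hΛ] at hv
    by_cases h1 : a v 1 = 0
    · simp only [s, if_pos h1] at hne
      rwa [show X v = 1 from (Int.units_eq_one_or _).resolve_right hne]
    · simp only [s, if_neg h1] at hne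
      rw [(spin_ne_one_iff _).1 hne]
      exact hv.resolve_left h1
  have hsum : ∑ X ∈ agreeSet Λ (fun v => s v), magnetize μ φ X = Z / (K * T) := by
    rw [sum_congr rfl hin, ← sum_div]
    congr 1
    exact sum_subset (subset_univ _) fun X _ hX => hout X hX
  have hKT : 0 < K * T := mul_pos hKpos hTpos
  refine ⟨φ, Λ, fun v => s v, hφ, fun τ => ?_, ?_, ?_⟩
  · exact div_nonneg (mul_nonneg (hμ τ) (prod_nonneg fun v _ => (hφ v).1.le)) hTpos.le
  · rw [marginal, hsum]
    exact div_pos hZ hKT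
  · ext X
    rw [pin, condOn, hsum]
    split_ifs with h
    · rw [hin X h, div_div_div_cancel_right₀ hKT.ne']
    · change 0 = W X / Z
      rw [hout X h, zero_div]

/-- Complete spectral independence bounds the off-diagonal covariance form of every single-site
reweighting of `μ` that favours `-1` or forbids a spin. -/
lemma CompletelySpectrallyIndependent.sum_covar_le {μ : (V → Spin) → ℝ} (hμ : ∀ τ, 0 ≤ μ τ)
    {η : ℝ} (hη : 0 ≤ η) (h : CompletelySpectrallyIndependent μ η) (a : V → Spin → ℝ)
    (ha : ∀ v s, 0 ≤ a v s) (ha' : ∀ v, a v (-1) = 0 ∨ a v 1 ≤ a v (-1))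
    (hZ : 0 < ∑ X, μ X * ∏ v, a v (X v)) {w : (V → Spin) → ℝ}
    (hw : w = fun X => (μ X * ∏ v, a v (X v)) / ∑ X, μ X * ∏ v, a v (X v)) (x : V → ℝ) :
    ∑ u, ∑ v, (if u = v then 0 else x u * x v * covar w (plus u) (plus v)) ≤
      η * ∑ u, x u ^ 2 * covar w (plus u) (plus u) := by
  obtain ⟨φ, Λ, σ, hφ, h0, hσ, he⟩ := exists_pin_magnetize_eq hμ a ha ha' hZ
  rw [hw, ← he]
  exact (h φ hφ).sum_covar_le h0 hη Λ σ hσ x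

end Tilt

/-! ### Mutually exclusive indicators at one vertex -/

section OneHot

variable {ι : Type*} [Fintype ι]

/-- The variance of a linear combination of mutually exclusive indicators of probabilities
`u i * P`, where `u` is bounded by `1 / 2` or concentrated at one point. -/
lemma sum_sq_sub_sq_sum_le (u c : ι → ℝ) (P : ℝ) (hP0 : 0 ≤ P) (hP1 : P ≤ 1)
    (hu0 : ∀ i, 0 ≤ u i)
    (hu : (∀ i, u i ≤ 1 / 2) ∨ ∃ i₀, u i₀ = 1 ∧ ∀ i, i ≠ i₀ → u i = 0) :
    ∑ i, c i ^ 2 * (u i * P) - (∑ i, c i * (u i * P)) ^ 2 ≤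
      2 * ∑ i, c i ^ 2 * (u i * P * (1 - u i * P)) := by
  rcases hu with hu | ⟨i₀, h1, h0⟩
  -- The factor `2` comes from `1 - u i * P ≥ 1 / 2`. In the concentrated case a single indicator
  -- remains and the factor `1` would do.
  · have : ∑ i, c i ^ 2 * (u i * P) ≤ 2 * ∑ i, c i ^ 2 * (u i * P * (1 - u i * P)) := by
      rw [mul_sum]
      refine sum_le_sum fun i _ => ?_
      have h2 : u i * P ≤ 1 / 2 :=
        (mul_le_of_le_one_right (hu0 i) hP1).trans (hu i)
      have h3 : 0 ≤ c i ^ 2 * (u i * P) := mul_nonneg (sq_nonneg _) (mul_nonneg (hu0 i) hP0)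
      nlinarith
    linarith [sq_nonneg (∑ i, c i * (u i * P))]
  · rw [Fintype.sum_eq_single i₀ fun i hi => by simp [h0 i hi],
      Fintype.sum_eq_single i₀ fun i hi => by simp [h0 i hi],
      Fintype.sum_eq_single i₀ fun i hi => by simp [h0 i hi], h1]
    have : 0 ≤ c i₀ ^ 2 * (P * (1 - P)) :=
      mul_nonneg (sq_nonneg _) (mul_nonneg hP0 (sub_nonneg.2 hP1))
    nlinarith

/-- Jensen for the subprobability `u`, then `1 - P ≤ 1 - u i * P`. This charges the variance of a
vertex to the variances of its copies. -/
lemma sq_sum_mul_le (u c : ι → ℝ) (P : ℝ) (hP0 : 0 ≤ P) (hP1 : P ≤ 1)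
    (hu0 : ∀ i, 0 ≤ u i) (hu1 : ∑ i, u i ≤ 1) :
    (∑ i, c i * u i) ^ 2 * (P * (1 - P)) ≤ ∑ i, c i ^ 2 * (u i * P * (1 - u i * P)) := by
  have h1 : (∑ i, c i * u i) ^ 2 ≤ ∑ i, c i ^ 2 * u i := by
    have h2 : (∑ i, c i * u i) ^ 2 ≤ (∑ i, c i ^ 2 * u i) * ∑ i, u i :=
      sum_sq_le_sum_mul_sum_of_sq_le_mul univ
        (fun i _ => mul_nonneg (sq_nonneg _) (hu0 i)) (fun i _ => hu0 i)
        fun i _ => le_of_eq (by ring)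
    exact h2.trans (mul_le_of_le_one_right
      (sum_nonneg fun i _ => mul_nonneg (sq_nonneg _) (hu0 i)) hu1)
  calc _ ≤ (∑ i, c i ^ 2 * u i) * (P * (1 - P)) :=
        mul_le_mul_of_nonneg_right h1 (mul_nonneg hP0 (sub_nonneg.2 hP1))
    _ ≤ _ := by
        rw [sum_mul]
        refine sum_le_sum fun i _ => ?_
        have h2 : u i ≤ 1 := (single_le_sum (fun j _ => hu0 j) (mem_univ i)).trans hu1
        have h3 : 0 ≤ c i ^ 2 * u i * P := mul_nonneg (mul_nonneg (sq_nonneg _) (hu0 i)) hP0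
        have h4 : u i * P ≤ P := mul_le_of_le_one_left hP0 h2
        nlinarith

end OneHot

/-! ### Pinnings of the `k`-transformation -/

section KTransform

variable {V : Type*} [Fintype V] [DecidableEq V] {k : ℕ}

/-- The indicator of the event that the choice of the index `j` at a vertex `v` of spin `s`
complies with the configuration `τ` on `Λ`. -/
noncomputable def compat (Λ : Finset (V × Fin k)) (τ : V × Fin k → Spin) (v : V) (s : Spin)
    (j : Fin k) : ℝ :=
  if ∀ i, (v, i) ∈ Λ → (if s = 1 ∧ i = j then (1 : Spin) else -1) = τ (v, i) then 1 else 0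

/-- The probability that a uniform index at a vertex `v` of spin `s` complies with `τ` on `Λ`. -/
noncomputable def compatProb (Λ : Finset (V × Fin k)) (τ : V × Fin k → Spin) (v : V)
    (s : Spin) : ℝ :=
  (∑ j, compat Λ τ v s j) / k

/-- The conditional probability that `j` is chosen at a vertex `v` of spin `+1`, given that the
choice complies with `τ` on `Λ`. -/
noncomputable def condIndex (Λ : Finset (V × Fin k)) (τ : V × Fin k → Spin) (v : V)
    (j : Fin k) : ℝ :=
  compat Λ τ v 1 j / ∑ j, compat Λ τ v 1 j

lemma compat_nonneg (Λ : Finset (V × Fin k)) (τ : V × Fin k → Spin) (v : V) (s : Spin)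
    (j : Fin k) : 0 ≤ compat Λ τ v s j := by
  unfold compat; split_ifs <;> norm_num

lemma compat_le_one (Λ : Finset (V × Fin k)) (τ : V × Fin k → Spin) (v : V) (s : Spin)
    (j : Fin k) : compat Λ τ v s j ≤ 1 := by
  unfold compat; split_ifs <;> norm_num

lemma compat_eq_zero_or_one (Λ : Finset (V × Fin k)) (τ : V × Fin k → Spin) (v : V) (s : Spin)
    (j : Fin k) : compat Λ τ v s j = 0 ∨ compat Λ τ v s j = 1 := by
  unfold compat; split_ifs <;> simp

lemma compatProb_nonneg (Λ : Finset (V × Fin k)) (τ : V × Fin k → Spin) (v : V) (s : Spin) :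
    0 ≤ compatProb Λ τ v s :=
  div_nonneg (sum_nonneg fun j _ => compat_nonneg _ _ _ _ j) (Nat.cast_nonneg k)

/-- At spin `-1` every copy is `-1`, so compliance does not depend on the index: all indices comply
or none does. This is the condition that keeps the fields in `(0,1]`. -/
lemma compatProb_neg_one (Λ : Finset (V × Fin k)) (τ : V × Fin k → Spin) (v : V) :
    compatProb Λ τ v (-1) = 0 ∨ compatProb Λ τ v 1 ≤ compatProb Λ τ v (-1) := by
  by_cases h : ∀ i, (v, i) ∈ Λ → (-1 : Spin) = τ (v, i)
  · right
    unfold compatProb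
    gcongr with j
    refine (compat_le_one Λ τ v 1 j).trans (le_of_eq ?_)
    simpa [compat, show (-1 : Spin) ≠ 1 by decide] using h
  · left
    have : ∀ j, compat Λ τ v (-1) j = 0 := fun j => by
      simpa [compat, show (-1 : Spin) ≠ 1 by decide] using h
    simp [compatProb, this]

lemma condIndex_nonneg (Λ : Finset (V × Fin k)) (τ : V × Fin k → Spin) (v : V) (j : Fin k) :
    0 ≤ condIndex Λ τ v j :=
  div_nonneg (compat_nonneg _ _ _ _ _) (sum_nonneg fun j _ => compat_nonneg _ _ _ _ j)

lemma sum_condIndex_le_one (Λ : Finset (V × Fin k)) (τ : V × Fin k → Spin) (v : V) :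
    ∑ j, condIndex Λ τ v j ≤ 1 := by
  simp only [condIndex, ← sum_div]
  exact div_self_le_one _

/-- The conditional index is uniform on the compliant indices: one of them gives a point mass, two
or more give masses at most `1 / 2`, and none gives `0` by the division convention. -/
lemma condIndex_le_half_or (Λ : Finset (V × Fin k)) (τ : V × Fin k → Spin) (v : V) :
    (∀ j, condIndex Λ τ v j ≤ 1 / 2) ∨
      ∃ j₀, condIndex Λ τ v j₀ = 1 ∧ ∀ j, j ≠ j₀ → condIndex Λ τ v j = 0 := by
  by_cases h : ∃ j₀, compat Λ τ v 1 j₀ = 1 ∧ ∀ j, j ≠ j₀ → compat Λ τ v 1 j = 0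
  · obtain ⟨j₀, h1, h0⟩ := h
    right
    refine ⟨j₀, ?_, fun j hj => by rw [condIndex, h0 j hj, zero_div]⟩
    rw [condIndex, Fintype.sum_eq_single j₀ h0, h1, div_one]
  · left
    intro j
    rcases compat_eq_zero_or_one Λ τ v 1 j with h0 | h1
    · rw [condIndex, h0, zero_div]; norm_num
    · push Not at h
      obtain ⟨j', hj', hne⟩ := h j h1
      have h1' := (compat_eq_zero_or_one Λ τ v 1 j').resolve_left hne
      have : (2 : ℝ) ≤ ∑ i, compat Λ τ v 1 i := by
        calc (2 : ℝ) = ∑ i ∈ {j, j'}, compat Λ τ v 1 i := by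
              rw [sum_pair hj'.symm, h1, h1']; norm_num
          _ ≤ _ := sum_le_sum_of_subset_of_nonneg (subset_univ _)
              fun i _ _ => compat_nonneg _ _ _ _ i
      rw [condIndex, h1]
      exact one_div_le_one_div_of_le two_pos this

lemma kTransform_nonneg {μ : (V → Spin) → ℝ} (hμ : ∀ τ, 0 ≤ μ τ) (k : ℕ) (Y : V × Fin k → Spin) :
    0 ≤ kTransform μ k Y := by
  refine sum_nonneg fun X _ => sum_nonneg fun i _ => ?_
  split_ifs
  · exact mul_nonneg (hμ X) (by positivity)
  · exact le_rfl

lemma sum_kTransform_mul (μ : (V → Spin) → ℝ) (G : (V × Fin k → Spin) → ℝ) :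
    ∑ Y, kTransform μ k Y * G Y =
      ∑ X, μ X * ∑ i : V → Fin k, 1 / (Fintype.card (V → Fin k) : ℝ) * G (spread X i) := by
  simp only [kTransform, sum_mul, mul_sum]
  rw [sum_comm]
  refine sum_congr rfl fun X _ => ?_
  rw [sum_comm]
  refine sum_congr rfl fun i _ => ?_
  simp only [ite_mul, zero_mul]
  rw [sum_ite_eq, if_pos (mem_univ _)]
  ring

lemma average_prod (g : V → Fin k → ℝ) :
    ∑ i : V → Fin k, 1 / (Fintype.card (V → Fin k) : ℝ) * ∏ v, g v (i v) =
      ∏ v, (∑ j, g v j) / k := by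
  rw [← mul_sum, prod_div_distrib, prod_univ_sum, Fintype.piFinset_univ]
  simp [div_eq_inv_mul]

lemma spread_mem_agreeSet_iff (Λ : Finset (V × Fin k)) (τ : V × Fin k → Spin) (X : V → Spin)
    (i : V → Fin k) :
    (if spread X i ∈ agreeSet Λ (fun p => τ p) then (1 : ℝ) else 0) =
      ∏ v, compat Λ τ v (X v) (i v) := by
  simp only [compat]
  rw [prod_ite_zero]
  simp only [prod_const_one]
  refine if_congr ?_ rfl rfl
  simp only [agreeSet, mem_filter, mem_univ, true_and, Subtype.forall, Prod.forall, spread,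
    forall_true_left]

/-- Averages of products of single-vertex observables over the choices that comply with `τ`. -/
lemma sum_kTransform_agreeSet (μ : (V → Spin) → ℝ) (Λ : Finset (V × Fin k))
    (τ : V × Fin k → Spin) (G : (V × Fin k → Spin) → ℝ) (g : V → Spin → Fin k → ℝ)
    (hG : ∀ X i, G (spread X i) = ∏ v, g v (X v) (i v)) (h : V → Spin → ℝ)
    (hgh : ∀ v s, (∑ j, compat Λ τ v s j * g v s j) / k = compatProb Λ τ v s * h v s) :
    ∑ Y ∈ agreeSet Λ (fun p => τ p), kTransform μ k Y * G Y =
      ∑ X, (μ X * ∏ v, compatProb Λ τ v (X v)) * ∏ v, h v (X v) := by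
  have h1 : ∑ Y ∈ agreeSet Λ (fun p => τ p), kTransform μ k Y * G Y =
      ∑ Y, kTransform μ k Y * ((if Y ∈ agreeSet Λ (fun p => τ p) then 1 else 0) * G Y) := by
    simp only [ite_mul, one_mul, zero_mul, mul_ite, mul_zero]
    rw [← sum_filter, filter_mem_eq_inter, univ_inter]
  rw [h1, sum_kTransform_mul]
  refine sum_congr rfl fun X _ => ?_
  simp only [spread_mem_agreeSet_iff, hG, ← prod_mul_distrib]
  rw [average_prod fun v j => compat Λ τ v (X v) j * g v (X v) j, mul_assoc, ← prod_mul_distrib]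
  simp only [hgh]

lemma plus_spread (v : V) (i : Fin k) (X : V → Spin) (j : V → Fin k) :
    plus (v, i) (spread X j) = if X v = 1 ∧ i = j v then 1 else 0 := by
  unfold plus spread
  by_cases h : X v = 1 ∧ i = j v
  · simp [h]
  · simp only [if_neg h, show (-1 : Spin) ≠ 1 by decide, if_false]

/-- Given `τ` on `Λ`, the vertex spins follow a reweighting of `μ`. -/
noncomputable def compatLaw (μ : (V → Spin) → ℝ) (Λ : Finset (V × Fin k))
    (τ : V × Fin k → Spin) (X : V → Spin) : ℝ :=
  (μ X * ∏ v, compatProb Λ τ v (X v)) / ∑ X, μ X * ∏ v, compatProb Λ τ v (X v)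

lemma sum_agreeSet_kTransform (μ : (V → Spin) → ℝ) (Λ : Finset (V × Fin k))
    (τ : V × Fin k → Spin) :
    ∑ Y ∈ agreeSet Λ (fun p => τ p), kTransform μ k Y =
      ∑ X, μ X * ∏ v, compatProb Λ τ v (X v) := by
  have := sum_kTransform_agreeSet μ Λ τ (fun _ => 1) (fun _ _ _ => 1) (by simp) (fun _ _ => 1)
    (by simp [compatProb])
  simpa using this

/-- Given the vertex spins, the indices are independent, so a product observable averages vertex by
vertex; `h` plays the role of the conditional mean of `g` given compliance. -/
lemma expect_pin_kTransform (μ : (V → Spin) → ℝ) (Λ : Finset (V × Fin k))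
    (τ : V × Fin k → Spin) (G : (V × Fin k → Spin) → ℝ) (g : V → Spin → Fin k → ℝ)
    (hG : ∀ X i, G (spread X i) = ∏ v, g v (X v) (i v)) (h : V → Spin → ℝ)
    (hgh : ∀ v s, (∑ j, compat Λ τ v s j * g v s j) / k = compatProb Λ τ v s * h v s) :
    expect (pin (kTransform μ k) Λ (fun p => τ p)) G =
      expect (compatLaw μ Λ τ) (fun X => ∏ v, h v (X v)) := by
  have h1 := sum_kTransform_agreeSet μ Λ τ G g hG h hgh
  simp only [expect, pin, condOn, compatLaw, ite_mul, zero_mul]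
  rw [← sum_filter, filter_mem_eq_inter, univ_inter, sum_agreeSet_kTransform]
  simp only [div_mul_eq_mul_div, ← sum_div, h1]

lemma sum_compat_mul_indicator (Λ : Finset (V × Fin k)) (τ : V × Fin k → Spin) (v : V)
    (i : Fin k) (s : Spin) :
    (∑ j, compat Λ τ v s j * (if s = 1 ∧ i = j then 1 else 0)) / k =
      compatProb Λ τ v s * (condIndex Λ τ v i * if s = 1 then 1 else 0) := by
  by_cases hs : s = 1
  · subst hs
    simp only [true_and, mul_ite, mul_one, mul_zero, sum_ite_eq, mem_univ, if_true, compatProb,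
      condIndex]
    by_cases h0 : ∑ j, compat Λ τ v 1 j = 0
    · rw [(sum_eq_zero_iff_of_nonneg fun j _ => compat_nonneg Λ τ v 1 j).1 h0 i (mem_univ _)]
      simp
    · field_simp
  · simp [hs]

lemma expect_plus_kTransform (μ : (V → Spin) → ℝ) (Λ : Finset (V × Fin k))
    (τ : V × Fin k → Spin) (v : V) (i : Fin k) :
    expect (pin (kTransform μ k) Λ (fun p => τ p)) (plus (v, i)) =
      condIndex Λ τ v i * expect (compatLaw μ Λ τ) (plus v) := by
  rw [expect_pin_kTransform μ Λ τ (plus (v, i))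
    (fun v' s j => if v' = v then (if s = 1 ∧ i = j then 1 else 0) else 1)
    (fun X j => by rw [plus_spread, prod_ite_eq' univ v, if_pos (mem_univ _)])
    (fun v' s => if v' = v then condIndex Λ τ v i * (if s = 1 then 1 else 0) else 1)
    (fun v' s => by
      by_cases hv : v' = v
      · subst hv
        simpa using sum_compat_mul_indicator Λ τ v' i s
      · simp [hv, compatProb]), ← expect_smul]
  congr 1
  ext X
  rw [prod_ite_eq' univ v, if_pos (mem_univ _), plus]

lemma expect_plus_mul_plus_kTransform (μ : (V → Spin) → ℝ) (Λ : Finset (V × Fin k))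
    (τ : V × Fin k → Spin) {v v' : V} (hv : v ≠ v') (i i' : Fin k) :
    expect (pin (kTransform μ k) Λ (fun p => τ p)) (fun Y => plus (v, i) Y * plus (v', i') Y) =
      condIndex Λ τ v i * condIndex Λ τ v' i' *
        expect (compatLaw μ Λ τ) (fun X => plus v X * plus v' X) := by
  rw [expect_pin_kTransform μ Λ τ (fun Y => plus (v, i) Y * plus (v', i') Y)
    (fun x s j => (if x = v then (if s = 1 ∧ i = j then 1 else 0) else 1) *
      (if x = v' then (if s = 1 ∧ i' = j then 1 else 0) else 1))
    (fun X j => by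
      rw [prod_mul_distrib, plus_spread, plus_spread, prod_ite_eq' univ v, prod_ite_eq' univ v',
        if_pos (mem_univ _), if_pos (mem_univ _)])
    (fun x s => (if x = v then condIndex Λ τ v i * (if s = 1 then 1 else 0) else 1) *
      (if x = v' then condIndex Λ τ v' i' * (if s = 1 then 1 else 0) else 1))
    (fun x s => by
      by_cases hx : x = v
      · subst hx
        simpa [hv] using sum_compat_mul_indicator Λ τ x i s
      · by_cases hx' : x = v'
        · subst hx'
          simpa [hx] using sum_compat_mul_indicator Λ τ x i' s
        · simp [hx, hx', compatProb]), ← expect_smul]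
  congr 1
  ext X
  rw [prod_mul_distrib, prod_ite_eq' univ v, prod_ite_eq' univ v', if_pos (mem_univ _),
    if_pos (mem_univ _), plus, plus]
  ring

lemma expect_plus_mul_plus_same (μ : (V → Spin) → ℝ) (Λ : Finset (V × Fin k))
    (τ : V × Fin k → Spin) (v : V) {i i' : Fin k} (hi : i ≠ i') :
    expect (pin (kTransform μ k) Λ (fun p => τ p)) (fun Y => plus (v, i) Y * plus (v, i') Y) =
      0 := by
  rw [expect_pin_kTransform μ Λ τ (fun Y => plus (v, i) Y * plus (v, i') Y)
    (fun x _ _ => if x = v then 0 else 1)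
    (fun X j => by
      rw [prod_ite_eq' univ v, if_pos (mem_univ _), plus_spread, plus_spread]
      by_cases h : i = j v
      · have : i' ≠ j v := fun h' => hi (h.trans h'.symm)
        simp [this]
      · simp [h])
    (fun x _ => if x = v then 0 else 1)
    (fun x s => by by_cases hx : x = v <;> simp [hx, compatProb])]
  refine sum_eq_zero fun X _ => ?_
  rw [prod_ite_eq' univ v, if_pos (mem_univ _), mul_zero]

lemma covar_plus_kTransform (μ : (V → Spin) → ℝ) (Λ : Finset (V × Fin k))
    (τ : V × Fin k → Spin) (v v' : V) (i i' : Fin k) :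
    covar (pin (kTransform μ k) Λ (fun p => τ p)) (plus (v, i)) (plus (v', i')) =
      if v = v' then
        (if i = i' then condIndex Λ τ v i * expect (compatLaw μ Λ τ) (plus v) else 0) -
          (condIndex Λ τ v i * expect (compatLaw μ Λ τ) (plus v)) *
          (condIndex Λ τ v i' * expect (compatLaw μ Λ τ) (plus v))
      else condIndex Λ τ v i * condIndex Λ τ v' i' *
        covar (compatLaw μ Λ τ) (plus v) (plus v') := by
  rw [covar, expect_plus_kTransform, expect_plus_kTransform]
  split_ifs with hv hi
  · subst hv hi
    congr 1
    rw [← expect_plus_kTransform]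
    congr 1
    ext Y
    simp [plus]
  · subst hv
    rw [expect_plus_mul_plus_same _ _ _ _ hi]
  · rw [expect_plus_mul_plus_kTransform _ _ _ hv, covar]
    ring

/-- Under complete spectral independence of `μ`, the covariance form of every conditional
distribution of the `k`-transformation of `μ` is bounded by its diagonal. -/
lemma CompletelySpectrallyIndependent.covar_kTransform_le {μ : (V → Spin) → ℝ}
    (hμ : ∀ τ, 0 ≤ μ τ) {η : ℝ} (hη : 0 ≤ η) (h : CompletelySpectrallyIndependent μ η)
    (Λ : Finset (V × Fin k)) (τ : V × Fin k → Spin)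
    (hτ : 0 < ∑ Y ∈ agreeSet Λ (fun p => τ p), kTransform μ k Y) (c : V × Fin k → ℝ) :
    covar (pin (kTransform μ k) Λ (fun p => τ p)) (fun Y => ∑ p, c p * plus p Y)
        (fun Y => ∑ p, c p * plus p Y) ≤
      (η + 2) * ∑ p, c p ^ 2 *
        covar (pin (kTransform μ k) Λ (fun p => τ p)) (plus p) (plus p) := by
  rw [sum_agreeSet_kTransform] at hτ
  have hπ : compatLaw μ Λ τ ∈ stdSimplex ℝ (V → Spin) := by
    refine ⟨fun X => div_nonneg (mul_nonneg (hμ X) (prod_nonneg fun v _ =>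
      compatProb_nonneg Λ τ v _)) hτ.le, ?_⟩
    simp only [compatLaw, ← sum_div]
    exact div_self hτ.ne'
  set u := condIndex Λ τ
  set P : V → ℝ := fun v => expect (compatLaw μ Λ τ) (plus v)
  have hP0 : ∀ v, 0 ≤ P v := fun v => expect_nonneg hπ.1 fun X => by
    unfold plus; split_ifs <;> norm_num
  have hP1 : ∀ v, P v ≤ 1 := fun v => by
    rw [← expect_const hπ 1]
    exact expect_mono hπ.1 fun X => by unfold plus; split_ifs <;> norm_num
  have hvar : ∀ v, covar (compatLaw μ Λ τ) (plus v) (plus v) = P v * (1 - P v) := fun v => by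
    have : (fun X : V → Spin => plus v X * plus v X) = plus v := by ext X; simp [plus]
    rw [covar, this]
    ring
  have hS := CompletelySpectrallyIndependent.sum_covar_le hμ hη h (compatProb Λ τ)
    (compatProb_nonneg Λ τ) (compatProb_neg_one Λ τ) hτ (w := compatLaw μ Λ τ) rfl
    (fun v => ∑ i, c (v, i) * u v i)
  rw [covar_linear_combination]
  simp only [Fintype.sum_prod_type, covar_plus_kTransform, if_true]
  -- The copies of `v` itself form a variance of exclusive indicators; the rest is the off-diagonal
  -- form of `μ` reweighted, at the coefficients `∑ i, c (v, i) * u v i`.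
  have hL : ∀ v, ∑ i, ∑ v', ∑ i', c (v, i) * c (v', i') *
      (if v = v' then (if i = i' then u v i * P v else 0) - u v i * P v * (u v i' * P v)
        else u v i * u v' i' * covar (compatLaw μ Λ τ) (plus v) (plus v')) =
      (∑ i, c (v, i) ^ 2 * (u v i * P v) - (∑ i, c (v, i) * (u v i * P v)) ^ 2) +
      ∑ v', if v = v' then 0 else (∑ i, c (v, i) * u v i) * (∑ i, c (v', i) * u v' i) *
        covar (compatLaw μ Λ τ) (plus v) (plus v') := by
    intro v
    rw [sum_comm]
    have hdiag : ∑ i, ∑ i', c (v, i) * c (v, i') *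
        ((if i = i' then u v i * P v else 0) - u v i * P v * (u v i' * P v)) =
        ∑ i, c (v, i) ^ 2 * (u v i * P v) - (∑ i, c (v, i) * (u v i * P v)) ^ 2 := by
      rw [sq (∑ i, c (v, i) * (u v i * P v)), sum_mul_sum, ← sum_sub_distrib]
      refine sum_congr rfl fun i _ => ?_
      simp only [mul_sub, sum_sub_distrib, mul_ite, mul_zero, sum_ite_eq, mem_univ, if_true]
      congr 1
      · ring
      · exact sum_congr rfl fun i' _ => by ring
    rw [← hdiag, ← add_sum_erase univ _ (mem_univ v),
      ← add_sum_erase univ (fun v' => if v = v' then (0 : ℝ) else _) (mem_univ v)]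
    simp only [if_true, zero_add]
    congr 1
    refine sum_congr rfl fun v' hv' => ?_
    have hne : v ≠ v' := (ne_of_mem_erase hv').symm
    simp only [if_neg hne]
    rw [sum_mul_sum, sum_mul]
    refine sum_congr rfl fun i _ => ?_
    rw [sum_mul]
    exact sum_congr rfl fun i' _ => by ring
  refine (le_of_eq (sum_congr rfl fun v _ => hL v)).trans ?_
  rw [sum_add_distrib]
  have hA : ∑ v, (∑ i, c (v, i) ^ 2 * (u v i * P v) - (∑ i, c (v, i) * (u v i * P v)) ^ 2) ≤
      2 * ∑ v, ∑ i, c (v, i) ^ 2 * (u v i * P v * (1 - u v i * P v)) := by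
    rw [mul_sum]
    exact sum_le_sum fun v _ => sum_sq_sub_sq_sum_le (u v) (fun i => c (v, i)) (P v) (hP0 v)
      (hP1 v) (condIndex_nonneg Λ τ v) (condIndex_le_half_or Λ τ v)
  have hB : ∑ v, (∑ i, c (v, i) * u v i) ^ 2 * covar (compatLaw μ Λ τ) (plus v) (plus v) ≤
      ∑ v, ∑ i, c (v, i) ^ 2 * (u v i * P v * (1 - u v i * P v)) :=
    sum_le_sum fun v _ => by
      rw [hvar]
      exact sq_sum_mul_le (u v) (fun i => c (v, i)) (P v) (hP0 v) (hP1 v)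
        (condIndex_nonneg Λ τ v) (sum_condIndex_le_one Λ τ v)
  have hC := mul_le_mul_of_nonneg_left hB hη
  have hR : ∑ v, ∑ i, c (v, i) ^ 2 * (u v i * P v - u v i * P v * (u v i * P v)) =
      ∑ v, ∑ i, c (v, i) ^ 2 * (u v i * P v * (1 - u v i * P v)) :=
    sum_congr rfl fun v _ => sum_congr rfl fun i _ => by ring
  change _ ≤ (η + 2) * ∑ v, ∑ i, c (v, i) ^ 2 * (u v i * P v - u v i * P v * (u v i * P v))
  rw [hR]
  linarith

end KTransform

/-! ### Decay of conditional variance as sites are revealed -/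

section LocalToGlobal

variable {U : Type*} [Fintype U] [DecidableEq U]

lemma mem_agreeSet {Λ : Finset U} {τ τ' : U → Spin} :
    τ' ∈ agreeSet Λ (fun v => τ v) ↔ ∀ v ∈ Λ, τ' v = τ v := by
  simp [agreeSet]

lemma agreeSet_congr {Λ : Finset U} {τ τ' : U → Spin} (h : τ' ∈ agreeSet Λ (fun v => τ v)) :
    agreeSet Λ (fun v => τ' v) = agreeSet Λ (fun v => τ v) := by
  rw [mem_agreeSet] at h
  ext σ
  simp only [mem_agreeSet]
  exact forall₂_congr fun v hv => by rw [h v hv]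

lemma sum_agreeSet_pos {ν : (U → Spin) → ℝ} (hν : ∀ τ, 0 ≤ ν τ) (Λ : Finset U) {τ : U → Spin}
    (hτ : 0 < ν τ) : 0 < ∑ τ' ∈ agreeSet Λ (fun v => τ v), ν τ' :=
  sum_pos' (fun σ _ => hν σ) ⟨τ, mem_agreeSet.2 fun _ _ => rfl, hτ⟩

lemma pin_mem_stdSimplex {ν : (U → Spin) → ℝ} (hν : ∀ τ, 0 ≤ ν τ) (Λ : Finset U) {τ : U → Spin}
    (hτ : 0 < ν τ) : pin ν Λ (fun v => τ v) ∈ stdSimplex ℝ (U → Spin) :=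
  condOn_mem_stdSimplex hν (sum_agreeSet_pos hν Λ hτ)

/-- Resampling from the conditional distribution is reversible. -/
lemma mul_pin_comm (ν : (U → Spin) → ℝ) (Λ : Finset U) (τ τ' : U → Spin) :
    ν τ * pin ν Λ (fun v => τ v) τ' = ν τ' * pin ν Λ (fun v => τ' v) τ := by
  unfold pin condOn
  by_cases h : τ' ∈ agreeSet Λ (fun v => τ v)
  · have h' : τ ∈ agreeSet Λ (fun v => τ' v) :=
      mem_agreeSet.2 fun v hv => (mem_agreeSet.1 h v hv).symm
    rw [if_pos h, if_pos h', agreeSet_congr h]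
    ring
  · have h' : τ ∉ agreeSet Λ (fun v => τ' v) := fun h' =>
      h (mem_agreeSet.2 fun v hv => (mem_agreeSet.1 h' v hv).symm)
    rw [if_neg h, if_neg h', mul_zero, mul_zero]

/-- The tower property: resampling is reversible, hence preserves `ν`. -/
lemma sum_mul_expect_pin {ν : (U → Spin) → ℝ} (hν : ∀ τ, 0 ≤ ν τ) (Λ : Finset U)
    (h : (U → Spin) → ℝ) :
    ∑ τ, ν τ * expect (pin ν Λ (fun v => τ v)) h = ∑ τ, ν τ * h τ := by
  simp only [expect, mul_sum]
  rw [sum_comm]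
  refine sum_congr rfl fun τ _ => ?_
  simp only [← mul_assoc, fun σ => mul_pin_comm ν Λ σ τ]
  rw [← sum_mul, ← mul_sum]
  rcases (hν τ).eq_or_lt with h0 | h0
  · rw [← h0]; ring
  · rw [(pin_mem_stdSimplex hν Λ h0).2, mul_one]

/-- The law of total variance for the value at a single vertex. -/
lemma expect_covar_pinVertex {w : (U → Spin) → ℝ} (hw : w ∈ stdSimplex ℝ (U → Spin)) (u : U)
    (f : (U → Spin) → ℝ) :
    expect w (fun τ => covar (pinVertex w u (τ u)) f f) =
      covar w f f - covar w f (plus u) ^ 2 / covar w (plus u) (plus u) := by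
  set Z : Spin → ℝ := vertexMarginal w u
  let A : ((U → Spin) → ℝ) → Spin → ℝ := fun g c => ∑ τ, if τ u = c then w τ * g τ else 0
  have hsplit : ∀ g : (U → Spin) → ℝ, expect w g = A g 1 + A g (-1) := fun g => by
    simp only [A, expect, ← sum_add_distrib]
    refine sum_congr rfl fun τ _ => ?_
    rcases Int.units_eq_one_or (τ u) with h | h <;> simp [h, show (-1 : Spin) ≠ 1 by decide,
      show (1 : Spin) ≠ -1 by decide]
  have hA0 : ∀ g c, Z c = 0 → A g c = 0 := fun g c hc => by
    refine sum_eq_zero fun τ _ => ?_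
    split_ifs with h
    · rw [(sum_eq_zero_iff_of_nonneg fun τ _ => hw.1 τ).1 hc τ (by simp [h]), zero_mul]
    · rfl
  have hpin : ∀ g c, expect (pinVertex w u c) g = A g c / Z c := fun g c => by
    simp only [expect, pinVertex, condOn, A, sum_div, mem_filter, mem_univ, true_and]
    refine sum_congr rfl fun τ _ => ?_
    split_ifs
    · exact div_mul_eq_mul_div _ _ _
    · rw [zero_mul, zero_div]
  have hcomp : ∀ H : Spin → ℝ, expect w (fun τ => H (τ u)) = Z 1 * H 1 + Z (-1) * H (-1) :=
    fun H => by
      rw [hsplit]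
      congr 1 <;>
      · simp only [A, Z, vertexMarginal, sum_mul, sum_filter, ite_mul, zero_mul]
        refine sum_congr rfl fun τ _ => ?_
        split_ifs with h
        · rw [h]
        · rfl
  have hcov : ∀ c, Z c * covar (pinVertex w u c) f f =
      A (fun τ => f τ * f τ) c - A f c ^ 2 / Z c := fun c => by
    rw [covar, hpin, hpin]
    by_cases hc : Z c = 0
    · simp [hA0 _ c hc, hc]
    · field_simp
  have hfp : expect w (fun τ => f τ * plus u τ) = A f 1 := by
    refine sum_congr rfl fun τ _ => ?_
    simp [plus]
  rw [hcomp fun c => covar (pinVertex w u c) f f, hcov, hcov, covar_plus_self hw, covar, covar,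
    hfp, expect_plus, hsplit, hsplit f]
  have hZ : Z 1 + Z (-1) = 1 := vertexMarginal_add hw u
  change _ = _ - (A f 1 - (A f 1 + A f (-1)) * Z 1) ^ 2 / (Z 1 * Z (-1))
  -- If `u` is deterministic, the subtracted quotient is `0 / 0 = 0` and nothing is lost.
  by_cases h1 : Z 1 = 0
  · rw [hA0 f 1 h1, h1, show Z (-1) = 1 by linarith]
    ring
  by_cases h2 : Z (-1) = 0
  · rw [hA0 f (-1) h2, h2, show Z 1 = 1 by linarith]
    ring
  have h3 : Z (-1) = 1 - Z 1 := by linarith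
  rw [h3] at h2 ⊢
  field_simp
  ring

lemma condOn_condOn {ν : (U → Spin) → ℝ} {E : Finset (U → Spin)} (hE : ∑ τ ∈ E, ν τ ≠ 0)
    (F : Finset (U → Spin)) : condOn (condOn ν E) F = condOn ν (E ∩ F) := by
  ext τ
  have : ∑ ω ∈ F, condOn ν E ω = (∑ ω ∈ E ∩ F, ν ω) / ∑ ω ∈ E, ν ω := by
    simp only [condOn]
    rw [← sum_filter, filter_mem_eq_inter, ← sum_div, inter_comm]
  by_cases hF : τ ∈ F <;> by_cases hE' : τ ∈ E
  · rw [condOn, if_pos hF, this, condOn, if_pos hE', condOn, if_pos (mem_inter.2 ⟨hE', hF⟩),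
      div_div_div_cancel_right₀ hE]
  · rw [condOn, if_pos hF, condOn, if_neg hE', condOn, if_neg fun h => hE' (mem_inter.1 h).1,
      zero_div]
  · rw [condOn, if_neg hF, condOn, if_neg fun h => hF (mem_inter.1 h).2]
  · rw [condOn, if_neg hF, condOn, if_neg fun h => hF (mem_inter.1 h).2]

lemma pin_insert {ν : (U → Spin) → ℝ} (hν : ∀ τ, 0 ≤ ν τ) (Λ : Finset U) (u : U)
    {τ τ' : U → Spin} (hτ : 0 < ν τ) (hτ' : pin ν Λ (fun v => τ v) τ' ≠ 0) :
    pin ν (insert u Λ) (fun v => τ' v) = pinVertex (pin ν Λ (fun v => τ v)) u (τ' u) := by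
  have hmem : τ' ∈ agreeSet Λ (fun v => τ v) := by
    by_contra hn
    exact hτ' (if_neg hn)
  rw [pinVertex, pin, pin, condOn_condOn (sum_agreeSet_pos hν Λ hτ).ne', ← agreeSet_congr hmem]
  congr 1
  ext σ
  simp [mem_agreeSet, and_comm]

/-- The expected conditional variance of `f` given the configuration on `Λ`. -/
noncomputable def condVariance (ν : (U → Spin) → ℝ) (f : (U → Spin) → ℝ) (Λ : Finset U) : ℝ :=
  ∑ τ, ν τ * covar (pin ν Λ (fun v => τ v)) f f

/-- If the covariance form of every conditional distribution is bounded by `C` times its diagonal,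
then revealing a uniformly random further vertex preserves most of the conditional variance. -/
lemma le_sum_condVariance_insert {ν : (U → Spin) → ℝ} (hν : ∀ τ, 0 ≤ ν τ) {C : ℝ} (hC : 0 ≤ C)
    (h : ∀ (Λ : Finset U) (τ : U → Spin), 0 < ν τ → ∀ c : U → ℝ,
      covar (pin ν Λ (fun v => τ v)) (fun Y => ∑ p, c p * plus p Y)
        (fun Y => ∑ p, c p * plus p Y) ≤
      C * ∑ p, c p ^ 2 * covar (pin ν Λ (fun v => τ v)) (plus p) (plus p))
    (f : (U → Spin) → ℝ) (Λ : Finset U) :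
    ((Fintype.card U : ℝ) - Λ.card - C) * condVariance ν f Λ ≤
      ∑ u ∈ Λᶜ, condVariance ν f (insert u Λ) := by
  -- Resampling `τ` given its values on `Λ` preserves `ν`, so the law of total variance applies
  -- inside each pinning.
  have h1 : ∀ u : U, condVariance ν f (insert u Λ) = ∑ τ, ν τ * (covar (pin ν Λ (fun v => τ v)) f f -
      covar (pin ν Λ (fun v => τ v)) f (plus u) ^ 2 /
        covar (pin ν Λ (fun v => τ v)) (plus u) (plus u)) := fun u => by
    rw [condVariance, ← sum_mul_expect_pin hν Λ
      (fun σ => covar (pin ν (insert u Λ) (fun v => σ v)) f f)]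
    refine sum_congr rfl fun τ _ => ?_
    rcases (hν τ).eq_or_lt with h0 | h0
    · rw [← h0, zero_mul, zero_mul]
    · rw [← expect_covar_pinVertex (pin_mem_stdSimplex hν Λ h0) u f]
      refine congrArg (ν τ * ·) ?_
      unfold expect
      refine sum_congr rfl fun τ' _ => ?_
      by_cases hz : pin ν Λ (fun v => τ v) τ' = 0
      · rw [hz, zero_mul, zero_mul]
      · simp only [pin_insert hν Λ u h0 hz]
  simp only [h1]
  rw [sum_comm, condVariance, mul_sum]
  refine sum_le_sum fun τ _ => ?_
  rcases (hν τ).eq_or_lt with h0 | h0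
  · simp [← h0]
  have hw := pin_mem_stdSimplex hν Λ h0
  have h2 := sum_covar_sq_div_le hw plus hC (h Λ τ h0) f
  set w := pin ν Λ (fun v => τ v)
  have h3 : ∑ u ∈ Λᶜ, covar w f (plus u) ^ 2 / covar w (plus u) (plus u) ≤
      ∑ u, covar w f (plus u) ^ 2 / covar w (plus u) (plus u) :=
    sum_le_sum_of_subset_of_nonneg (subset_univ _) fun u _ _ =>
      div_nonneg (sq_nonneg _) (covar_self_nonneg hw _)
  rw [← mul_sum, sum_sub_distrib, sum_const, card_compl, nsmul_eq_mul,
    Nat.cast_sub (card_le_univ Λ), mul_left_comm]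
  refine mul_le_mul_of_nonneg_left ?_ h0.le
  rw [sub_mul _ C]
  exact sub_le_sub_left (h3.trans h2) _

/-- Double counting: each set of size `t + 1` arises once for each of its elements as the inserted
one. -/
lemma sum_powersetCard_sum_insert (D : Finset U → ℝ) (t : ℕ) :
    ∑ Λ ∈ powersetCard t univ, ∑ u ∈ Λᶜ, D (insert u Λ) =
      (t + 1) * ∑ Λ ∈ powersetCard (t + 1) univ, D Λ := by
  have h1 : ((t : ℝ) + 1) * ∑ Λ ∈ powersetCard (t + 1) (univ : Finset U), D Λ =
      ∑ Λ ∈ powersetCard (t + 1) (univ : Finset U), ∑ u ∈ Λ, D Λ := by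
    rw [mul_sum]
    refine sum_congr rfl fun Λ hΛ => ?_
    rw [sum_const, (mem_powersetCard.1 hΛ).2, nsmul_eq_mul]
    push_cast
    rfl
  rw [h1, sum_sigma', sum_sigma']
  refine sum_bij' (fun p _ => ⟨insert p.2 p.1, p.2⟩) (fun p _ => ⟨p.1.erase p.2, p.2⟩)
    ?_ ?_ ?_ ?_ ?_
  · rintro ⟨Λ, u⟩ hp
    simp only [mem_sigma, mem_powersetCard_univ, mem_compl] at hp ⊢
    exact ⟨by rw [card_insert_of_notMem hp.2, hp.1], mem_insert_self _ _⟩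
  · rintro ⟨Λ, u⟩ hp
    simp only [mem_sigma, mem_powersetCard_univ, mem_compl] at hp ⊢
    exact ⟨by rw [card_erase_of_mem hp.2, hp.1]; rfl, notMem_erase _ _⟩
  · rintro ⟨Λ, u⟩ hp
    simp only [mem_sigma, mem_compl] at hp
    simp [erase_insert hp.2]
  · rintro ⟨Λ, u⟩ hp
    simp only [mem_sigma] at hp
    simp [insert_erase hp.2]
  · rintro ⟨Λ, u⟩ _
    rfl

/-- With `x = C / m ≤ 1 / 2`, the chain is `(1 - 1/m)^(2C) ≤ e^(-2x) ≤ 1/(1 + 2x) ≤ 1 - x`. The last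
step is `x (1 - 2x) ≥ 0`, which is why the exponent is doubled. -/
lemma one_sub_inv_rpow_le {C m : ℝ} (hC : 0 < C) (hm : 1 ≤ m) (hCm : 2 * C ≤ m) :
    ((m - 1) / m) ^ (2 * C) ≤ 1 - C / m := by
  have hm0 : 0 < m := by linarith
  set x := C / m with hx
  have hx0 : 0 < x := div_pos hC hm0
  have hx1 : x ≤ 1 / 2 := by rw [hx, div_le_iff₀ hm0]; linarith
  have h1 : (m - 1) / m ≤ Real.exp (-(1 / m)) := by
    have := Real.add_one_le_exp (-(1 / m))
    have h2 : (m - 1) / m = -(1 / m) + 1 := by field_simp; ring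
    linarith
  calc ((m - 1) / m) ^ (2 * C) ≤ Real.exp (-(1 / m)) ^ (2 * C) :=
        Real.rpow_le_rpow (div_nonneg (by linarith) hm0.le) h1 (by linarith)
    _ = (Real.exp (2 * x))⁻¹ := by
        rw [← Real.exp_mul, ← Real.exp_neg]
        congr 1
        rw [hx]; ring
    _ ≤ (2 * x + 1)⁻¹ := inv_anti₀ (by linarith) (Real.add_one_le_exp _)
    _ ≤ 1 - x := by
        rw [inv_le_iff_one_le_mul₀ (by linarith)]
        nlinarith

/-- Averaged over the sets of size `t`, the conditional variance decays at most polynomially in the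
fraction of the vertices that are not revealed. -/
lemma le_sum_powersetCard_condVariance {ν : (U → Spin) → ℝ} (hν : ∀ τ, 0 ≤ ν τ) {C : ℝ}
    (hC : 0 < C)
    (h : ∀ (Λ : Finset U) (τ : U → Spin), 0 < ν τ → ∀ c : U → ℝ,
      covar (pin ν Λ (fun v => τ v)) (fun Y => ∑ p, c p * plus p Y)
        (fun Y => ∑ p, c p * plus p Y) ≤
      C * ∑ p, c p ^ 2 * covar (pin ν Λ (fun v => τ v)) (plus p) (plus p))
    (f : (U → Spin) → ℝ) {ℓ : ℕ} (hℓ : 2 * C ≤ ℓ) (hN : 0 < Fintype.card U)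
    (h0 : 0 ≤ condVariance ν f ∅) (t : ℕ) (ht : t + ℓ ≤ Fintype.card U) :
    ((Fintype.card U).choose t : ℝ) *
        ((((Fintype.card U : ℝ) - t) / Fintype.card U) ^ (2 * C) * condVariance ν f ∅) ≤
      ∑ Λ ∈ powersetCard t univ, condVariance ν f Λ := by
  set N := Fintype.card U
  have hN' : (0 : ℝ) < N := Nat.cast_pos.2 hN
  induction t with
  | zero => simp [hN'.ne']
  | succ t ih =>
    have ih' := ih (by omega)
    set W := fun s : ℕ => ∑ Λ ∈ powersetCard s (univ : Finset U), condVariance ν f Λ with hW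
    set D := condVariance ν f ∅ with hD
    have hstep : ((N : ℝ) - t - C) * W t ≤ (t + 1) * W (t + 1) := by
      rw [hW]
      simp only
      rw [← sum_powersetCard_sum_insert, mul_sum]
      refine sum_le_sum fun Λ hΛ => ?_
      have := le_sum_condVariance_insert hν hC.le h f Λ
      rwa [(mem_powersetCard.1 hΛ).2] at this
    have htN : (t : ℝ) + 1 + ℓ ≤ N := by exact_mod_cast ht
    set m : ℝ := (N : ℝ) - t with hm
    have hm1 : 1 ≤ m := by linarith [(Nat.cast_nonneg ℓ : (0 : ℝ) ≤ ℓ)]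
    have hmC : 2 * C ≤ m := by linarith
    have hm0 : 0 < m := by linarith
    have hchoose : (N.choose (t + 1) : ℝ) * (t + 1) = N.choose t * m := by
      have := Nat.choose_succ_right_eq N t
      have h2 : ((N - t : ℕ) : ℝ) = m := by rw [Nat.cast_sub (by omega)]
      rw [← h2]
      exact_mod_cast this
    have hnum := one_sub_inv_rpow_le hC hm1 hmC
    have hsplit : ((m - 1) / N) ^ (2 * C) = ((m - 1) / m) ^ (2 * C) * (m / N) ^ (2 * C) := by
      rw [← Real.mul_rpow (div_nonneg (by linarith) hm0.le) (div_nonneg hm0.le hN'.le)]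
      congr 1
      field_simp
    -- One factor of the telescoping product; `m ≥ ℓ + 1` gives the required `m ≥ 2 * C`.
    have hmain : ((m - 1) / N) ^ (2 * C) * m ≤ (m - C) * (m / N) ^ (2 * C) := by
      have h3 : m - C = (1 - C / m) * m := by field_simp
      rw [hsplit, h3]
      have h4 : 0 ≤ (m / N) ^ (2 * C) := Real.rpow_nonneg (div_nonneg hm0.le hN'.le) _
      nlinarith [mul_le_mul_of_nonneg_right hnum (mul_nonneg h4 hm0.le)]
    have hcast : (N : ℝ) - ((t + 1 : ℕ) : ℝ) = m - 1 := by rw [hm]; push_cast; ring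
    rw [hcast]
    have ht1 : (0 : ℝ) < t + 1 := by positivity
    refine le_of_mul_le_mul_left ?_ ht1
    refine le_trans ?_ hstep
    refine le_trans ?_ (mul_le_mul_of_nonneg_left ih' (by linarith))
    have h5 : 0 ≤ (N.choose t : ℝ) * D := mul_nonneg (Nat.cast_nonneg _) h0
    calc ((t : ℝ) + 1) * (N.choose (t + 1) * (((m - 1) / N) ^ (2 * C) * D))
        = (N.choose t * D) * (((m - 1) / N) ^ (2 * C) * m) := by
          linear_combination (((m - 1) / N) ^ (2 * C) * D) * hchoose
      _ ≤ (N.choose t * D) * ((m - C) * (m / N) ^ (2 * C)) := mul_le_mul_of_nonneg_left hmain h5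
      _ = _ := by ring

lemma condVariance_empty {ν : (U → Spin) → ℝ} (hν : ν ∈ stdSimplex ℝ (U → Spin))
    (f : (U → Spin) → ℝ) : condVariance ν f ∅ = covar ν f f := by
  have : ∀ τ : U → Spin, pin ν ∅ (fun v => τ v) = ν := fun τ => by
    ext σ
    rw [pin, condOn, if_pos (mem_agreeSet.2 (by simp))]
    have : agreeSet (∅ : Finset U) (fun v => τ v) = univ := by
      ext σ; simp [agreeSet]
    rw [this, hν.2, div_one]
  simp only [condVariance, this, ← sum_mul, hν.2, one_mul]

/-- The expected conditional variance is the Dirichlet form of the resampling step. -/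
lemma condVariance_eq_dirichlet {ν : (U → Spin) → ℝ} (hν : ∀ τ, 0 ≤ ν τ)
    (f : (U → Spin) → ℝ) (Λ : Finset U) :
    condVariance ν f Λ = ∑ τ, ν τ * f τ ^ 2 -
      ∑ τ, ∑ τ', ν τ * f τ * pin ν Λ (fun v => τ v) τ' * f τ' := by
  set E : (U → Spin) → ℝ := fun τ => expect (pin ν Λ (fun v => τ v)) f with hE
  -- Conditional expectation is a projection: `E` is constant on configurations that agree on `Λ`.
  have h1 : ∑ τ, ν τ * (E τ * E τ) = ∑ τ, ν τ * (f τ * E τ) := by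
    rw [← sum_mul_expect_pin hν Λ (fun τ => f τ * E τ)]
    refine sum_congr rfl fun τ _ => ?_
    congr 1
    change E τ * expect (pin ν Λ (fun v => τ v)) f = _
    unfold expect
    rw [mul_sum]
    refine sum_congr rfl fun τ' _ => ?_
    by_cases hz : pin ν Λ (fun v => τ v) τ' = 0
    · rw [hz, zero_mul, zero_mul, mul_zero]
    · have hmem : τ' ∈ agreeSet Λ (fun v => τ v) := by
        by_contra hn
        exact hz (if_neg hn)
      have : E τ' = E τ := by
        simp only [hE, pin, agreeSet_congr hmem]
      simp only [this]
      ring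
  have h2 : ∑ τ, ν τ * expect (pin ν Λ (fun v => τ v)) (fun σ => f σ * f σ) =
      ∑ τ, ν τ * (f τ * f τ) := sum_mul_expect_pin hν Λ _
  simp only [condVariance, covar, mul_sub, sum_sub_distrib, h2]
  congr 1
  · exact sum_congr rfl fun τ _ => by ring
  · refine h1.trans (sum_congr rfl fun τ _ => ?_)
    simp only [hE, expect, mul_sum]
    exact sum_congr rfl fun τ' _ => by ring

end LocalToGlobal

/-! ### Gap of the block dynamics -/

section BlockGap

variable {U : Type*} [Fintype U] [DecidableEq U]

lemma sum_powersetCard_compl (D : Finset U → ℝ) {ℓ : ℕ} (hℓ : ℓ ≤ Fintype.card U) :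
    ∑ S ∈ powersetCard ℓ univ, D Sᶜ =
      ∑ Λ ∈ powersetCard (Fintype.card U - ℓ) univ, D Λ := by
  refine sum_bij' (fun S _ => Sᶜ) (fun Λ _ => Λᶜ) ?_ ?_ ?_ ?_ ?_
  · intro S hS
    simp only [mem_powersetCard_univ] at hS ⊢
    rw [card_compl, hS]
  · intro Λ hΛ
    simp only [mem_powersetCard_univ] at hΛ ⊢
    rw [card_compl, hΛ]
    omega
  · exact fun S _ => compl_compl S
  · exact fun S _ => compl_compl S
  · exact fun S _ => rfl

/-- If the covariance form of every conditional distribution of `ν` is bounded by `C` times its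
diagonal, then the spectral gap of the uniform block dynamics is polynomial in the fraction of
resampled vertices. -/
lemma rpow_le_spectralGap_blockDynamics {ν : (U → Spin) → ℝ} (hν : ν ∈ stdSimplex ℝ (U → Spin))
    {C : ℝ} (hC : 0 < C)
    (h : ∀ (Λ : Finset U) (τ : U → Spin), 0 < ν τ → ∀ c : U → ℝ,
      covar (pin ν Λ (fun v => τ v)) (fun Y => ∑ p, c p * plus p Y)
        (fun Y => ∑ p, c p * plus p Y) ≤
      C * ∑ p, c p ^ 2 * covar (pin ν Λ (fun v => τ v)) (plus p) (plus p))
    {ℓ : ℕ} (hℓ : 2 * C ≤ ℓ) (hℓU : ℓ ≤ Fintype.card U) [Fintype (Omega ν)]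
    [DecidableEq (Omega ν)] :
    ((ℓ : ℝ) / Fintype.card U) ^ (2 * C) ≤ spectralGap (blockDynamics ν ℓ) := by
  have hℓ0 : (0 : ℝ) < ℓ := by linarith
  have hU : 0 < Fintype.card U := (Nat.cast_pos.1 hℓ0).trans_le hℓU
  have hU' : (0 : ℝ) < Fintype.card U := Nat.cast_pos.2 hU
  have hcard : (powersetCard ℓ (univ : Finset U)).card = (Fintype.card U).choose ℓ := by
    rw [card_powersetCard, card_univ]
  have hch : (0 : ℝ) < (Fintype.card U).choose ℓ := Nat.cast_pos.2 (Nat.choose_pos hℓU)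
  have hP : ∀ x y : Omega ν, blockDynamics ν ℓ x y = 1 / ((Fintype.card U).choose ℓ : ℝ) *
      ∑ S ∈ powersetCard ℓ univ, pin ν Sᶜ (fun v => x.1 v) y.1 := fun x y => by
    rw [blockDynamics, Matrix.of_apply, hcard]
  refine le_spectralGap_of_poincare _ (fun x => ν x.1) (fun x => x.2) (fun x y => ?_) _
    (Real.rpow_le_one (by positivity)
      ((div_le_one hU').2 (Nat.cast_le.2 hℓU)) (by linarith)) fun f hf => ?_
  · rw [hP, hP, mul_left_comm, mul_left_comm (ν y.1)]
    simp only [mul_sum, mul_pin_comm ν _ x.1 y.1]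
  classical
  -- Extension by zero turns sums over the support into sums over all configurations.
  let F : (U → Spin) → ℝ := fun τ => if hτ : 0 < ν τ then f ⟨τ, hτ⟩ else 0
  have hF : ∀ x : Omega ν, F x.1 = f x := fun x => dif_pos x.2
  have hoff : ∀ τ, ¬ 0 < ν τ → ν τ = 0 := fun τ hτ => le_antisymm (not_lt.1 hτ) (hν.1 τ)
  have hFoff : ∀ τ, ¬ 0 < ν τ → F τ = 0 := fun τ hτ => dif_neg hτ
  have e1 : ∑ x : Omega ν, ν x.1 * f x ^ 2 = ∑ τ, ν τ * F τ ^ 2 := by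
    rw [← sum_subtype_eq_sum (fun τ => 0 < ν τ) _ fun τ hτ => by rw [hoff τ hτ, zero_mul]]
    simp only [hF]
  have e2 : expect ν F = 0 := by
    rw [expect, ← sum_subtype_eq_sum (fun τ => 0 < ν τ) _ fun τ hτ => by rw [hoff τ hτ, zero_mul]]
    simpa only [hF] using hf
  have e3 : ∀ S : Finset U, ∑ x : Omega ν, ∑ y : Omega ν,
      ν x.1 * f x * pin ν Sᶜ (fun v => x.1 v) y.1 * f y =
      ∑ τ, ν τ * F τ ^ 2 - condVariance ν F Sᶜ := fun S => by
    rw [condVariance_eq_dirichlet hν.1, sub_sub_cancel,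
      ← sum_subtype_eq_sum (fun τ => 0 < ν τ) _ fun τ hτ => by simp [hoff τ hτ]]
    refine sum_congr rfl fun x _ => ?_
    rw [← sum_subtype_eq_sum (fun τ => 0 < ν τ) _ fun τ hτ => by rw [hFoff τ hτ, mul_zero]]
    simp only [hF]
  have e4 : ∑ x : Omega ν, ∑ y : Omega ν, ν x.1 * f x * blockDynamics ν ℓ x y * f y =
      ∑ τ, ν τ * F τ ^ 2 - 1 / ((Fintype.card U).choose ℓ : ℝ) *
        ∑ S ∈ powersetCard ℓ univ, condVariance ν F Sᶜ := by
    have h1 : ∀ x y : Omega ν, ν x.1 * f x * blockDynamics ν ℓ x y * f y =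
        1 / ((Fintype.card U).choose ℓ : ℝ) * ∑ S ∈ powersetCard ℓ univ,
          ν x.1 * f x * pin ν Sᶜ (fun v => x.1 v) y.1 * f y := fun x y => by
      rw [hP, ← sum_mul, ← mul_sum]
      ring
    simp only [h1, ← mul_sum]
    have h2 : ∑ x : Omega ν, ∑ y : Omega ν, ∑ S ∈ powersetCard ℓ univ,
        ν x.1 * f x * pin ν Sᶜ (fun v => x.1 v) y.1 * f y =
        ∑ S ∈ powersetCard ℓ univ, ∑ x : Omega ν, ∑ y : Omega ν,
        ν x.1 * f x * pin ν Sᶜ (fun v => x.1 v) y.1 * f y :=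
      (sum_congr rfl fun x _ => sum_comm).trans sum_comm
    rw [h2]
    simp only [e3, sum_sub_distrib, sum_const, hcard, nsmul_eq_mul]
    field_simp
  have hvar : condVariance ν F ∅ = ∑ τ, ν τ * F τ ^ 2 := by
    rw [condVariance_empty hν, covar, e2, mul_zero, sub_zero]
    exact sum_congr rfl fun τ _ => by ring
  have key := le_sum_powersetCard_condVariance hν.1 hC h F hℓ hU
    (by rw [condVariance_empty hν]; exact covar_self_nonneg hν F) (Fintype.card U - ℓ) (by omega)
  rw [← sum_powersetCard_compl _ hℓU, Nat.choose_symm hℓU, Nat.cast_sub hℓU, sub_sub_cancel,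
    hvar] at key
  rw [e4, e1, sub_sub_cancel, one_div, ← div_eq_inv_mul, le_div_iff₀ hch]
  linarith

end BlockGap

/-! ### Conclusion -/

lemma kTransform_mem_stdSimplex {V : Type*} [Fintype V] [DecidableEq V] {μ : (V → Spin) → ℝ}
    (hμ : μ ∈ stdSimplex ℝ (V → Spin)) {k : ℕ} (hk : 1 ≤ k) :
    kTransform μ k ∈ stdSimplex ℝ (V × Fin k → Spin) := by
  refine ⟨kTransform_nonneg hμ.1 k, ?_⟩
  have h := sum_kTransform_mul (k := k) μ fun _ => 1
  have : Nonempty (Fin k) := ⟨⟨0, hk⟩⟩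
  have hc : (Fintype.card (V → Fin k) : ℝ) ≠ 0 := Nat.cast_ne_zero.2 Fintype.card_ne_zero
  simp only [mul_one, sum_const, card_univ, nsmul_eq_mul, mul_one_div_cancel hc, hμ.2] at h
  exact h

end BlockDynamics

theorem lemma2p6 {V : Type*} [Fintype V] [DecidableEq V]
    (μ : (V → BlockDynamics.Spin) → ℝ)
    (hμ : μ ∈ stdSimplex ℝ (V → BlockDynamics.Spin))
    (η : ℝ) (hη : 0 < η)
    (hSI : BlockDynamics.CompletelySpectrallyIndependent μ η)
    (k ℓ : ℕ) (hk : 1 ≤ k)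
    (hℓ : 2 * (η + 3) ≤ (ℓ : ℝ)) (hℓn : ℓ ≤ k * Fintype.card V) :
    ((ℓ : ℝ) / (2 * (k : ℝ) * (Fintype.card V : ℝ))) ^ (2 * η + 7) ≤
      BlockDynamics.spectralGap
        (BlockDynamics.blockDynamics (BlockDynamics.kTransform μ k) ℓ) := by
  have hcard : Fintype.card (V × Fin k) = k * Fintype.card V := by
    rw [Fintype.card_prod, Fintype.card_fin, mul_comm]
  have hℓ0 : (0 : ℝ) < ℓ := by linarith
  have hN : (ℓ : ℝ) ≤ k * Fintype.card V := by exact_mod_cast hℓn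
  have hN0 : (0 : ℝ) < k * Fintype.card V := hℓ0.trans_le hN
  have hν := BlockDynamics.kTransform_mem_stdSimplex hμ hk
  have hgap := BlockDynamics.rpow_le_spectralGap_blockDynamics hν (C := η + 2) (by linarith)
    (fun Λ τ hτ c => hSI.covar_kTransform_le hμ.1 hη.le Λ τ
      (BlockDynamics.sum_agreeSet_pos hν.1 Λ hτ) c) (ℓ := ℓ) (by linarith) (hℓn.trans_eq hcard.symm)
  -- The bound obtained is `(ℓ / (kn))^(2η + 4)`. The stated one is weaker: its base is halved, and
  -- raising the exponent of a base in `(0,1]` only lowers the value.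
  refine le_trans ?_ hgap
  rw [hcard, Nat.cast_mul]
  have h1 : (ℓ : ℝ) / (2 * k * Fintype.card V) ≤ ℓ / (k * Fintype.card V) :=
    div_le_div_of_nonneg_left hℓ0.le hN0 (by linarith)
  have h2 : 0 < (ℓ : ℝ) / (k * Fintype.card V) := div_pos hℓ0 hN0
  calc ((ℓ : ℝ) / (2 * k * Fintype.card V)) ^ (2 * η + 7)
      ≤ ((ℓ : ℝ) / (k * Fintype.card V)) ^ (2 * η + 7) :=
        Real.rpow_le_rpow (by positivity) h1 (by linarith)
    _ ≤ ((ℓ : ℝ) / (k * Fintype.card V)) ^ (2 * (η + 2)) :=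
        Real.rpow_le_rpow_of_exponent_ge h2 ((div_le_one hN0).2 hN) (by linarith)
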